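/- Let $k$ be a field. A representation of the continuous quiver $\mathbf Q=([0,1],<)$ is a functor from the poset $[0,1]$ to $k$-vector spaces, i.e. vector spaces $\mathbf M(x)$ $(x\in[0,1])$ with linear maps $\mathbf M(x,y):\mathbf M(x)\to\mathbf M(y)$ $(x<y)$ such that $\mathbf M(y,z)\mathbf M(x,y)=\mathbf M(x,z)$. For a nonempty interval $J\subseteq[0,1]$ (with open or closed ends; one-point intervals are allowed) let $\mathbf T_J$ be the representation with $\mathbf T_J(x)=k$ for $x\in J$ and $0$ otherwise, whose map from $x$ to $y$ is the identity if $x,y\in J$ and $0$ otherwise. Let $\mathrm{Rep}'_k(\mathbf Q)$ consist of the representations isomorphic to a direct sum $\bigoplus_{i\in I}\mathbf T_{J_i}$ over an arbitrary index set $I$. Let $\mathbf M\cong\bigoplus_{i\in I}\mathbf T_{J_i}$ be such a representation. It is *basic* if $\mathbf T_{J_i}\not\cong\mathbf T_{J_j}$ for $i\ne j$; it is *rigid* if its indecomposable summands have no extensions among each other, i.e. $\mathrm{Ext}^1(\mathbf T_{J_i},\mathbf T_{J_j})=0$ for all $i,j\in I$ (with $\mathrm{Ext}^1$ in the category of all representations).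 It is *maximal rigid* if it is basic and rigid and if, for every $\mathbf N\in\mathrm{Rep}'_k(\mathbf Q)$ such that $\mathbf M\oplus\mathbf N$ is rigid, $\mathbf N$ is a direct summand of a direct sum of (possibly infinitely many) copies of $\mathbf M$. Let $\alpha=(a_0,\dots,a_n)$ with $0=a_0<a_1<\dots<a_n=1$, and let $\hat I=\{J_i\mid i\in I\}$. For $c\in(a_s,a_{s+1})$ let $\phi^r_1(c),\phi^r_2(c),\phi^r_3(c),\phi^r_4(c)$ be the sets of all $d\in[a_{s+1},1]$ such that, respectively, $[c,d]$, $[c,d)$, $(c,d]$, $(c,d)$ belongs to $\hat I$, and let $\phi^l_1(c),\phi^l_2(c),\phi^l_3(c),\phi^l_4(c)$ be the sets of all $d\in[0,a_s]$ such that, respectively, $[d,c]$, $(d,c]$, $[d,c)$, $(d,c)$ belongs to $\hat I$. The representation $\mathbf M$ is *of type $\alpha$* if 1. for every $c\in[0,1]\setminus\{a_0,\dots,a_n\}$ one has $\phi^r_1(c)=\phi^r_3(c)$, $\phi^r_2(c)=\phi^r_4(c)$, $\phi^l_1(c)=\phi^l_3(c)$, $\phi^l_2(c)=\phi^l_4(c)$,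 all of these are subsets of $\{a_0,\dots,a_n\}$, and $|\phi^r_1(c)|+|\phi^r_2(c)|+|\phi^l_1(c)|+|\phi^l_2(c)|=1$; 2. for every $0\le s<n$, each of the eight sets $\phi^r_m(c)$, $\phi^l_m(c)$ $(1\le m\le4)$ is the same for all $c\in(a_s,a_{s+1})$. Then the set $\mathbf A$ of isomorphism classes of maximal rigid representations of type $\alpha$ is finite, and $$|\mathbf A|=\frac{2^{n-1}}{n+1}\binom{4n+2}{2n+1}.$$ -/

import Mathlib

open CategoryTheory CategoryTheory.Limits

universe u

namespace ContinuousQuiver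

/-- Representations over `k` of the continuous quiver `[0,1]` with its usual order: functors from
the poset `[0,1]` to `k`-vector spaces. -/
abbrev Rep (k : Type u) [Field k] : Type (u + 1) := unitInterval ⥤ ModuleCat.{u} k

instance hasExtRep (k : Type u) [Field k] : HasExt.{u + 1} (Rep k) := HasExt.standard _

/-- The nonempty intervals `|a,b|` of `[0,1]`, with any choice of open or closed ends; the
one-point intervals `[a,a]` are included. -/
def Interval : Type :=
  {S : Set unitInterval // S.Nonempty ∧ ∃ a b : unitInterval,
    S = Set.Icc a b ∨ S = Set.Ico a b ∨ S = Set.Ioc a b ∨ S = Set.Ioo a b}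

theorem Interval.ordConnected (S : Interval) : S.1.OrdConnected := by
  obtain ⟨S, -, a, b, rfl | rfl | rfl | rfl⟩ := S
  · exact Set.ordConnected_Icc
  · exact Set.ordConnected_Ico
  · exact Set.ordConnected_Ioc
  · exact Set.ordConnected_Ioo

open Classical in
/-- The structure map from `x` to `y` of the interval representation on `S`. The space at `x` is
`k` if `x ∈ S` and `0` otherwise, written as the functions to `k` on the proofs of `x ∈ S`; the map
is the identity of `k` if `x, y ∈ S` and zero otherwise. -/
noncomputable def intervalMap (k : Type u) [Field k] (S : Set unitInterval) (x y : unitInterval) :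
    (PLift (x ∈ S) → k) →ₗ[k] (PLift (y ∈ S) → k) where
  toFun f := fun _ => if hx : x ∈ S then f ⟨hx⟩ else 0
  map_add' f g := by
    funext _
    by_cases hx : x ∈ S <;> simp [hx]
  map_smul' c f := by
    funext _
    by_cases hx : x ∈ S <;> simp [hx]

/-- The interval representation `T_S`. -/
noncomputable def intervalRep (k : Type u) [Field k] (S : Interval) : Rep k where
  obj x := ModuleCat.of k (PLift (x ∈ S.1) → k)
  map {x y} _ := ModuleCat.ofHom (intervalMap k S.1 x y)
  map_id x := by
    refine ModuleCat.hom_ext (LinearMap.ext fun v => funext fun hx => ?_)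
    simp [intervalMap, hx.down]
  map_comp {x y z} f g := by
    refine ModuleCat.hom_ext (LinearMap.ext fun v => funext fun hz => ?_)
    by_cases hx : x ∈ S.1
    · have hy : y ∈ S.1 := S.ordConnected.out hx hz.down ⟨leOfHom f, leOfHom g⟩
      simp [intervalMap, hx, hy]
    · simp [intervalMap, hx]

/-- A decomposition `M ≅ ⨁ i, T_{S i}` into interval representations. -/
structure Decomposition {k : Type u} [Field k] (M : Rep k) where
  /-- the index set -/
  I : Type u
  /-- the intervals that occur -/
  S : I → Interval
  /-- the isomorphism with the direct sum -/
  iso : M ≅ ∐ fun i => intervalRep k (S i)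

/-- The summand with index `i`. -/
noncomputable def Decomposition.summand {k : Type u} [Field k] {M : Rep k} (D : Decomposition M)
    (i : D.I) : Rep k :=
  intervalRep k (D.S i)

/-- The set of the intervals that occur in a decomposition, as subsets of `[0,1]`. -/
def Decomposition.intervals {k : Type u} [Field k] {M : Rep k} (D : Decomposition M) :
    Set (Set unitInterval) :=
  Set.range fun i => (D.S i).1

/-- `M` is basic: its summands are pairwise non-isomorphic. -/
def IsBasic {k : Type u} [Field k] (M : Rep k) : Prop :=
  ∃ D : Decomposition M, ∀ i j : D.I, i ≠ j → IsEmpty (D.summand i ≅ D.summand j)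

/-- `M` is rigid: `Ext¹` vanishes between any two (equal or distinct) indecomposable summands of
`M`, with `Ext¹` taken in the abelian category of all representations. -/
def IsRigid {k : Type u} [Field k] (M : Rep k) : Prop :=
  ∃ D : Decomposition M, ∀ i j : D.I,
    Subsingleton (Abelian.Ext.{u + 1} (D.summand i) (D.summand j) 1)

/-- `N` belongs to `add M`: it is a direct summand of a direct sum of copies of `M`. -/
def InAdd {k : Type u} [Field k] (N M : Rep k) : Prop :=
  ∃ L : Type u, Nonempty (Retract N (∐ fun _ : L => M))

/-- `M` is maximal rigid, among the direct sums of interval representations. -/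
structure IsMaximalRigid {k : Type u} [Field k] (M : Rep k) : Prop where
  basic : IsBasic M
  rigid : IsRigid M
  maximal : ∀ N : Rep k, Nonempty (Decomposition N) → IsRigid (M ⊞ N) → InAdd N M

section TypeAlpha

variable {n : ℕ} (α : Fin (n + 1) → unitInterval) (X : Set (Set unitInterval))
  (s : Fin n) (c : unitInterval)

/-! The sets `φ_j^r(c)` and `φ_j^l(c)` for a set `X` of intervals and a point `c` of the gap
`(a_s, a_{s+1})`. -/

def phiR1 : Set unitInterval := {d | α s.succ ≤ d ∧ Set.Icc c d ∈ X}
def phiR2 : Set unitInterval := {d | α s.succ ≤ d ∧ Set.Ico c d ∈ X}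
def phiR3 : Set unitInterval := {d | α s.succ ≤ d ∧ Set.Ioc c d ∈ X}
def phiR4 : Set unitInterval := {d | α s.succ ≤ d ∧ Set.Ioo c d ∈ X}
def phiL1 : Set unitInterval := {d | d ≤ α s.castSucc ∧ Set.Icc d c ∈ X}
def phiL2 : Set unitInterval := {d | d ≤ α s.castSucc ∧ Set.Ioc d c ∈ X}
def phiL3 : Set unitInterval := {d | d ≤ α s.castSucc ∧ Set.Ico d c ∈ X}
def phiL4 : Set unitInterval := {d | d ≤ α s.castSucc ∧ Set.Ioo d c ∈ X}

end TypeAlpha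

/-- The conditions on the set `X` of intervals of a representation of type `α`. The points of
`[0,1]` that are not entries of `α` are the points of the gaps `(a_s, a_{s+1})`. -/
structure IntervalsOfType {n : ℕ} (α : Fin (n + 1) → unitInterval)
    (X : Set (Set unitInterval)) : Prop where
  r13 : ∀ s : Fin n, ∀ c ∈ Set.Ioo (α s.castSucc) (α s.succ),
    phiR1 α X s c = phiR3 α X s c ∧ phiR3 α X s c ⊆ Set.range α
  r24 : ∀ s : Fin n, ∀ c ∈ Set.Ioo (α s.castSucc) (α s.succ),
    phiR2 α X s c = phiR4 α X s c ∧ phiR4 α X s c ⊆ Set.range α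
  l13 : ∀ s : Fin n, ∀ c ∈ Set.Ioo (α s.castSucc) (α s.succ),
    phiL1 α X s c = phiL3 α X s c ∧ phiL3 α X s c ⊆ Set.range α
  l24 : ∀ s : Fin n, ∀ c ∈ Set.Ioo (α s.castSucc) (α s.succ),
    phiL2 α X s c = phiL4 α X s c ∧ phiL4 α X s c ⊆ Set.range α
  card : ∀ s : Fin n, ∀ c ∈ Set.Ioo (α s.castSucc) (α s.succ),
    (phiR1 α X s c).encard + (phiR2 α X s c).encard +
      (phiL1 α X s c).encard + (phiL2 α X s c).encard = 1
  const : ∀ s : Fin n, ∀ c ∈ Set.Ioo (α s.castSucc) (α s.succ),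
    ∀ f ∈ Set.Ioo (α s.castSucc) (α s.succ),
      phiR1 α X s c = phiR1 α X s f ∧ phiR2 α X s c = phiR2 α X s f ∧
      phiR3 α X s c = phiR3 α X s f ∧ phiR4 α X s c = phiR4 α X s f ∧
      phiL1 α X s c = phiL1 α X s f ∧ phiL2 α X s c = phiL2 α X s f ∧
      phiL3 α X s c = phiL3 α X s f ∧ phiL4 α X s c = phiL4 α X s f

/-- `M` is of type `α`. -/
def IsOfType {k : Type u} [Field k] {n : ℕ} (α : Fin (n + 1) → unitInterval) (M : Rep k) : Prop :=
  ∃ D : Decomposition M, IntervalsOfType α D.intervals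

/-- The set of isomorphism classes of maximal rigid representations of type `α`. -/
def maximalRigidClasses (k : Type u) [Field k] {n : ℕ} (α : Fin (n + 1) → unitInterval) :
    Set (Quotient (isIsomorphicSetoid (Rep k))) :=
  {q | ∃ M : Rep k, q = Quotient.mk _ M ∧ IsMaximalRigid M ∧ IsOfType α M}

end ContinuousQuiver

/-! An interval of [0,1] is the set of points between two cuts p < q, where each point x has a cut
`lo x` just before it and a cut `hi x` just after it. For the interval representations S of (p,q)
and T of (p',q'), Ext¹(S,T) is nonzero exactly when p < p' ≤ q < q' (`subsingleton_ext_iff`). In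
that case T embeds into the representation U of (p,q'), and S → U/T does not lift to U; otherwise a
lift can be built from one well-chosen base point. Endomorphisms of an interval representation are
scalars, so the set of interval summands is an isomorphism invariant and determines a basic
representation. Hence classes of maximal rigid representations are maximal noncrossing families of
pairs of cuts (`rigid_maximal_iff_maxNC`).

The points a_t give 2n+2 cuts, the grid; all other cuts lie in n open gaps. Type α says that all
cuts of a gap are joined across its ends to one common grid cut, on one side only: a fan
(`intervalsOfType_iff_hasFans`). Restricting to the grid and recording the side of each fan is a
bijection (`bijOn_restrict`). Indeed the restriction is again maximal, the apex of a fan is forced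
by the grid pairs (for a right fan it is the largest right partner of the right end of the gap, or
this end itself), and both sides are always possible.

A maximal noncrossing family on a chain of N+1 points is a binary tree with N nodes: the longest
pair is the root, and the remaining pairs fall into two disjoint blocks. So there are `catalan N` of
them (`ncard_setOf_maxNC_Icc`). With N = 2n+1 and n free choices of side, the count is 2^n ·
`catalan (2 * n + 1)`. -/

namespace ContinuousQuiver

/-! ### Morphisms out of interval representations -/

section Hom

variable {k : Type u} [Field k]

/-- The transition map of a representation, as a linear map. -/
noncomputable def tr (A : Rep k) {x y : unitInterval} (h : x ≤ y) : A.obj x →ₗ[k] A.obj y :=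
  (A.map (homOfLE h)).hom

theorem tr_self (A : Rep k) {x : unitInterval} (v : A.obj x) : tr A (le_refl x) v = v := by
  simp [tr]

theorem tr_tr (A : Rep k) {x y z : unitInterval} (h : x ≤ y) (h' : y ≤ z) (v : A.obj x) :
    tr A h' (tr A h v) = tr A (h.trans h') v := by
  have : A.map (homOfLE (h.trans h')) = A.map (homOfLE h) ≫ A.map (homOfLE h') := by
    rw [← A.map_comp]; rfl
  simp [tr, this]

/-- A component of a morphism of representations, as a linear map. -/
noncomputable def cmp {A B : Rep k} (f : A ⟶ B) (x : unitInterval) : A.obj x →ₗ[k] B.obj x :=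
  (f.app x).hom

theorem cmp_tr {A B : Rep k} (f : A ⟶ B) {x y : unitInterval} (h : x ≤ y) (v : A.obj x) :
    cmp f y (tr A h v) = tr B h (cmp f x v) := by
  simp [tr, cmp]

theorem cmp_comp {A B C : Rep k} (f : A ⟶ B) (g : B ⟶ C) (x : unitInterval) (v : A.obj x) :
    cmp (f ≫ g) x v = cmp g x (cmp f x v) := by
  simp [cmp]

theorem cmp_id (A : Rep k) (x : unitInterval) (v : A.obj x) : cmp (𝟙 A) x v = v := by
  simp [cmp]

theorem hom_ext_cmp {A B : Rep k} {f g : A ⟶ B} (h : ∀ x v, cmp f x v = cmp g x v) : f = g := by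
  ext x v
  exact h x v

/-- A morphism from a family of linear maps. -/
noncomputable def mkHom {A B : Rep k} (φ : ∀ x, A.obj x →ₗ[k] B.obj x)
    (h : ∀ x y (hxy : x ≤ y) v, φ y (tr A hxy v) = tr B hxy (φ x v)) : A ⟶ B where
  app x := ModuleCat.ofHom (φ x)
  naturality x y f := by
    ext v
    exact h x y (leOfHom f) v

theorem cmp_mkHom {A B : Rep k} (φ : ∀ x, A.obj x →ₗ[k] B.obj x)
    (h : ∀ x y (hxy : x ≤ y) v, φ y (tr A hxy v) = tr B hxy (φ x v)) (x : unitInterval) :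
    cmp (mkHom φ h) x = φ x := rfl

/-- The generator of the interval representation at a point. -/
def one (k : Type u) [Field k] (S : Interval) (x : unitInterval) : (intervalRep k S).obj x :=
  fun _ => (1 : k)

/-- The coordinate of a vector of an interval representation. -/
def coord {S : Interval} {x : unitInterval} (hx : x ∈ S.1) :
    (intervalRep k S).obj x →ₗ[k] k where
  toFun v := v ⟨hx⟩
  map_add' _ _ := rfl
  map_smul' _ _ := rfl

theorem coord_one {S : Interval} {x : unitInterval} (hx : x ∈ S.1) :
    coord hx (one k S x) = 1 := rfl

theorem eq_coord_smul {S : Interval} {x : unitInterval} (hx : x ∈ S.1)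
    (v : (intervalRep k S).obj x) : v = coord hx v • one k S x := by
  refine funext fun h => ?_
  change v h = coord hx v * 1
  rw [mul_one]
  rfl

theorem eq_zero_of_notMem {S : Interval} {x : unitInterval} (hx : x ∉ S.1)
    (v : (intervalRep k S).obj x) : v = 0 :=
  funext fun h => (hx h.down).elim

theorem tr_one {S : Interval} {x y : unitInterval} (h : x ≤ y) (hx : x ∈ S.1) :
    tr (intervalRep k S) h (one k S x) = one k S y := by
  refine funext fun hy => ?_
  change (intervalMap k S.1 x y) (fun _ => 1) hy = 1
  simp [intervalMap, hx]

theorem coord_tr {S : Interval} {x y : unitInterval} (h : x ≤ y) (hx : x ∈ S.1) (hy : y ∈ S.1)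
    (v : (intervalRep k S).obj x) : coord hy (tr (intervalRep k S) h v) = coord hx v := by
  rw [eq_coord_smul hx v, map_smul, tr_one h hx, map_smul, map_smul, coord_one, coord_one]

theorem tr_eq_zero_of_notMem {S : Interval} {x y : unitInterval} (h : x ≤ y) (hx : x ∉ S.1)
    (v : (intervalRep k S).obj x) : tr (intervalRep k S) h v = 0 := by
  rw [eq_zero_of_notMem hx v, map_zero]

open Classical in
/-- The morphism out of an interval representation that sends the generators to a given
compatible family of vectors. -/
noncomputable def homOfFamily {S : Interval} {A : Rep k} (a : ∀ x, x ∈ S.1 → A.obj x)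
    (h₁ : ∀ x y (hxy : x ≤ y) (hx : x ∈ S.1) (hy : y ∈ S.1), tr A hxy (a x hx) = a y hy)
    (h₂ : ∀ x y (hxy : x ≤ y) (hx : x ∈ S.1), y ∉ S.1 → tr A hxy (a x hx) = 0) :
    intervalRep k S ⟶ A :=
  mkHom (fun x => if hx : x ∈ S.1 then (LinearMap.toSpanSingleton k _ (a x hx)).comp (coord hx)
      else 0) (by
    intro x y hxy v
    by_cases hx : x ∈ S.1
    · by_cases hy : y ∈ S.1
      · simp [hx, hy, coord_tr hxy hx hy, h₁ x y hxy hx hy]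
      · simp [hx, hy, h₂ x y hxy hx hy]
    · simp [hx, tr_eq_zero_of_notMem hxy hx v])

theorem cmp_homOfFamily {S : Interval} {A : Rep k} {a : ∀ x, x ∈ S.1 → A.obj x}
    {h₁ : ∀ x y (hxy : x ≤ y) (hx : x ∈ S.1) (hy : y ∈ S.1), tr A hxy (a x hx) = a y hy}
    {h₂ : ∀ x y (hxy : x ≤ y) (hx : x ∈ S.1), y ∉ S.1 → tr A hxy (a x hx) = 0}
    {x : unitInterval} (hx : x ∈ S.1) :
    cmp (homOfFamily a h₁ h₂) x (one k S x) = a x hx := by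
  simp [homOfFamily, cmp_mkHom, hx, coord_one]

theorem hom_ext_one {S : Interval} {A : Rep k} {f g : intervalRep k S ⟶ A}
    (h : ∀ x ∈ S.1, cmp f x (one k S x) = cmp g x (one k S x)) : f = g := by
  refine hom_ext_cmp fun x v => ?_
  by_cases hx : x ∈ S.1
  · rw [eq_coord_smul hx v, map_smul, map_smul, h x hx]
  · rw [eq_zero_of_notMem hx v, map_zero, map_zero]

end Hom

/-! ### Injective representations and the vanishing criterion for `Ext¹` -/

section Injective

variable {k : Type u} [Field k]

/-- The representation coinduced from the vector spaces of `M`. -/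
noncomputable def coind (M : Rep k) : Rep k where
  obj x := ModuleCat.of k (∀ y : {y : unitInterval // x ≤ y}, M.obj y.1)
  map {x x'} h := ModuleCat.ofHom
    (LinearMap.pi fun y => LinearMap.proj (⟨y.1, (leOfHom h).trans y.2⟩ : {y // x ≤ y}))
  map_id x := by ext v; rfl
  map_comp f g := by ext v; rfl

/-- The unit of coinduction. -/
noncomputable def toCoind (M : Rep k) : M ⟶ coind M :=
  mkHom (fun _ => LinearMap.pi fun y => tr M y.2) (by
    intro x y hxy v
    funext z
    exact tr_tr M hxy z.2 v)

theorem toCoind_injective (M : Rep k) (x : unitInterval) :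
    Function.Injective (cmp (toCoind M) x) := by
  intro v w h
  have := congrFun h ⟨x, le_refl x⟩
  have h' : tr M (le_refl x) v = tr M (le_refl x) w := this
  rwa [tr_self, tr_self] at h'

theorem mono_of_injective {A B : Rep k} (f : A ⟶ B) (h : ∀ x, Function.Injective (cmp f x)) :
    Mono f := by
  rw [NatTrans.mono_iff_mono_app]
  exact fun x => (ModuleCat.mono_iff_injective _).2 (h x)

theorem injective_of_mono {A B : Rep k} (f : A ⟶ B) [Mono f] (x : unitInterval) :
    Function.Injective (cmp f x) :=
  (ModuleCat.mono_iff_injective _).1 ((NatTrans.mono_iff_mono_app f).1 inferInstance x)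

theorem surjective_of_epi {A B : Rep k} (f : A ⟶ B) [Epi f] (x : unitInterval) :
    Function.Surjective (cmp f x) :=
  (ModuleCat.epi_iff_surjective _).1 ((NatTrans.epi_iff_epi_app f).1 inferInstance x)

/-- A map into a coinduced representation is an arbitrary family of linear maps to the spaces M(y).
Over a field each such map extends along an injection by a pointwise retraction, and the retractions
need not be natural. -/
instance injective_coind (M : Rep k) : Injective (coind M) where
  factors {A B} g f _ := by
    choose r hr using fun y => (cmp f y).exists_leftInverse_of_injective
      (LinearMap.ker_eq_bot.2 (injective_of_mono f y))
    refine ⟨mkHom (fun x => LinearMap.pi fun y =>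
      ((LinearMap.proj (⟨y.1, le_refl _⟩ : {z // y.1 ≤ z})).comp (cmp g y.1)).comp
        ((r y.1).comp (tr B y.2))) ?_, ?_⟩
    · intro x y hxy v
      funext z
      change (cmp g z.1 (r z.1 (tr B z.2 (tr B hxy v)))) _ = (cmp g z.1 (r z.1 (tr B _ v))) _
      rw [tr_tr]
    · refine hom_ext_cmp fun x v => ?_
      rw [cmp_comp]
      funext z
      change (cmp g z.1 (r z.1 (tr B z.2 (cmp f x v)))) ⟨z.1, le_refl _⟩ = _
      rw [← cmp_tr f z.2 v]
      have : r z.1 (cmp f z.1 (tr A z.2 v)) = tr A z.2 v := LinearMap.congr_fun (hr z.1) _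
      rw [this, cmp_tr]
      rfl

/-- The short exact sequence that embeds a representation into an injective one. -/
noncomputable abbrev coindSeq (M : Rep k) : ShortComplex (Rep k) :=
  ShortComplex.mk (toCoind M) (cokernel.π (toCoind M)) (cokernel.condition _)

theorem coindSeq_shortExact (M : Rep k) : (coindSeq M).ShortExact := by
  have : Mono (toCoind M) := mono_of_injective _ (toCoind_injective M)
  exact { exact := ShortComplex.exact_of_g_is_cokernel _ (cokernelIsCokernel (toCoind M))
          mono_f := this
          epi_g := inferInstanceAs (Epi (cokernel.π (toCoind M))) }

/-- Elementwise form of short exactness. -/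
theorem exact_apply {S : ShortComplex (Rep k)} (hS : S.ShortExact) (x : unitInterval)
    {w : S.X₂.obj x} (hw : cmp S.g x w = 0) : ∃ v, cmp S.f x v = w := by
  have := (hS.exact.map ((evaluation unitInterval (ModuleCat.{u} k)).obj x))
  rw [ShortComplex.moduleCat_exact_iff] at this
  exact this w hw

/-- `Ext¹(X, M)` vanishes if morphisms from `X` lift along all epimorphisms with kernel `M`. -/
theorem subsingleton_ext_one {X M : Rep k}
    (h : ∀ (A B : Rep k) (f : M ⟶ A) (e : A ⟶ B) (w : f ≫ e = 0),
      (ShortComplex.mk f e w).ShortExact → ∀ g : X ⟶ B, ∃ g' : X ⟶ A, g' ≫ e = g) :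
    Subsingleton (Abelian.Ext.{u + 1} X M 1) := by
  refine subsingleton_of_forall_eq 0 fun x => ?_
  have : Injective (coindSeq M).X₂ := injective_coind M
  -- The class dies in the injective middle term, so it is the connecting image of a morphism to the
  -- cokernel; a lift of that morphism kills it.
  obtain ⟨y, rfl⟩ := Abelian.Ext.covariant_sequence_exact₁ X (coindSeq_shortExact M) x
    (Abelian.Ext.eq_zero_of_injective (n := 0) (I := (coindSeq M).X₂) _) (n₀ := 0) rfl
  obtain ⟨g, rfl⟩ := (Abelian.Ext.mk₀_bijective X _).2 y
  obtain ⟨g', rfl⟩ := h _ _ _ _ _ (coindSeq_shortExact M) g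
  rw [← Abelian.Ext.mk₀_comp_mk₀, Abelian.Ext.comp_assoc_of_second_deg_zero,
    (coindSeq_shortExact M).comp_extClass, Abelian.Ext.comp_zero]

/-- If `Ext¹(X, M)` vanishes, then morphisms from `X` lift along epimorphisms with kernel `M`. -/
theorem exists_lift_of_subsingleton_ext {X : Rep k} {S : ShortComplex (Rep k)} (hS : S.ShortExact)
    (h : Subsingleton (Abelian.Ext.{u + 1} X S.X₁ 1)) (g : X ⟶ S.X₃) :
    ∃ g' : X ⟶ S.X₂, g' ≫ S.g = g := by
  obtain ⟨y, hy⟩ := Abelian.Ext.covariant_sequence_exact₃ X hS (Abelian.Ext.mk₀ g) (n₁ := 1) rfl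
    (h.elim _ _)
  obtain ⟨g', rfl⟩ := (Abelian.Ext.mk₀_bijective X _).2 y
  rw [Abelian.Ext.mk₀_comp_mk₀] at hy
  exact ⟨g', (Abelian.Ext.mk₀_bijective X _).1 hy⟩

end Injective

/-! ### Cuts of the unit interval -/

/-- The cuts of `[0,1]`: each point `x` has a cut just below it and a cut just above it. -/
abbrev Cut : Type := unitInterval ×ₗ Bool

/-- The cut just below a point. -/
def lo (x : unitInterval) : Cut := toLex (x, false)

/-- The cut just above a point. -/
def hi (x : unitInterval) : Cut := toLex (x, true)

theorem lo_le_lo {x y : unitInterval} : lo x ≤ lo y ↔ x ≤ y := by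
  rw [lo, lo, Prod.Lex.toLex_le_toLex, le_iff_lt_or_eq (a := x)]; simp

theorem hi_le_hi {x y : unitInterval} : hi x ≤ hi y ↔ x ≤ y := by
  rw [hi, hi, Prod.Lex.toLex_le_toLex, le_iff_lt_or_eq (a := x)]; simp

theorem lo_le_hi {x y : unitInterval} : lo x ≤ hi y ↔ x ≤ y := by
  rw [lo, hi, Prod.Lex.toLex_le_toLex, le_iff_lt_or_eq (a := x)]; simp

theorem hi_le_lo {x y : unitInterval} : hi x ≤ lo y ↔ x < y := by
  simp [lo, hi, Prod.Lex.toLex_le_toLex]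

theorem lo_lt_lo {x y : unitInterval} : lo x < lo y ↔ x < y := by
  simp [lo, Prod.Lex.toLex_lt_toLex]

theorem hi_lt_hi {x y : unitInterval} : hi x < hi y ↔ x < y := by
  simp [hi, Prod.Lex.toLex_lt_toLex]

theorem lo_lt_hi {x y : unitInterval} : lo x < hi y ↔ x ≤ y := by
  simp [lo, hi, Prod.Lex.toLex_lt_toLex, le_iff_lt_or_eq]

theorem hi_lt_lo {x y : unitInterval} : hi x < lo y ↔ x < y := by
  simp [lo, hi, Prod.Lex.toLex_lt_toLex]

theorem cut_cases (p : Cut) : ∃ x, p = lo x ∨ p = hi x := by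
  obtain ⟨⟨x, b⟩, rfl⟩ := toLex.surjective p
  cases b
  · exact ⟨x, Or.inl rfl⟩
  · exact ⟨x, Or.inr rfl⟩

theorem le_lo_or_hi_le (p : Cut) (x : unitInterval) : p ≤ lo x ∨ hi x ≤ p := by
  obtain ⟨y, rfl | rfl⟩ := cut_cases p
  · rw [lo_le_lo, hi_le_lo]; exact le_or_gt y x
  · rw [hi_le_lo, hi_le_hi]; exact lt_or_ge y x

theorem lo_lt_hi_self (x : unitInterval) : lo x < hi x := lo_lt_hi.2 le_rfl

/-- Only `lo x` and `hi x` for the same x are adjacent, and they enclose x; between distinct points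
there is a third one. So p < q is exactly nonemptiness of the interval. -/
theorem exists_between_cuts {p q : Cut} (h : p < q) : ∃ x, p ≤ lo x ∧ hi x ≤ q := by
  obtain ⟨a, rfl | rfl⟩ := cut_cases p
  · refine ⟨a, le_rfl, ?_⟩
    exact (le_lo_or_hi_le q a).resolve_left (not_le.2 h)
  · obtain ⟨b, rfl | rfl⟩ := cut_cases q
    · obtain ⟨c, h₁, h₂⟩ := exists_between (hi_lt_lo.1 h)
      exact ⟨c, hi_le_lo.2 h₁, hi_le_lo.2 h₂⟩
    · exact ⟨b, hi_le_lo.2 (hi_lt_hi.1 h), le_rfl⟩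

/-- The points between two cuts. -/
def cutSet (p q : Cut) : Set unitInterval := {x | p ≤ lo x ∧ hi x ≤ q}

theorem cutSet_lo_hi (a b : unitInterval) : cutSet (lo a) (hi b) = Set.Icc a b := by
  ext x; simp [cutSet, lo_le_lo, hi_le_hi]

theorem cutSet_lo_lo (a b : unitInterval) : cutSet (lo a) (lo b) = Set.Ico a b := by
  ext x; simp [cutSet, lo_le_lo, hi_le_lo]

theorem cutSet_hi_hi (a b : unitInterval) : cutSet (hi a) (hi b) = Set.Ioc a b := by
  ext x; simp [cutSet, hi_le_lo, hi_le_hi]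

theorem cutSet_hi_lo (a b : unitInterval) : cutSet (hi a) (lo b) = Set.Ioo a b := by
  ext x; simp [cutSet, hi_le_lo]

/-- The interval between two cuts. -/
def itv {p q : Cut} (h : p < q) : Interval :=
  ⟨cutSet p q, exists_between_cuts h, by
    obtain ⟨a, rfl | rfl⟩ := cut_cases p <;> obtain ⟨b, rfl | rfl⟩ := cut_cases q
    · exact ⟨a, b, Or.inr (Or.inl (cutSet_lo_lo a b))⟩
    · exact ⟨a, b, Or.inl (cutSet_lo_hi a b)⟩
    · exact ⟨a, b, Or.inr (Or.inr (Or.inr (cutSet_hi_lo a b)))⟩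
    · exact ⟨a, b, Or.inr (Or.inr (Or.inl (cutSet_hi_hi a b)))⟩⟩

theorem exists_eq_itv (S : Interval) : ∃ (p q : Cut) (h : p < q), S = itv h := by
  have key : ∀ p q : Cut, (cutSet p q).Nonempty → p < q := fun p q ⟨x, h₁, h₂⟩ =>
    h₁.trans_lt ((lo_lt_hi_self x).trans_le h₂)
  obtain ⟨S, hS, a, b, rfl | rfl | rfl | rfl⟩ := S
  · rw [← cutSet_lo_hi] at hS
    exact ⟨_, _, key _ _ hS, Subtype.ext (cutSet_lo_hi a b).symm⟩
  · rw [← cutSet_lo_lo] at hS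
    exact ⟨_, _, key _ _ hS, Subtype.ext (cutSet_lo_lo a b).symm⟩
  · rw [← cutSet_hi_hi] at hS
    exact ⟨_, _, key _ _ hS, Subtype.ext (cutSet_hi_hi a b).symm⟩
  · rw [← cutSet_hi_lo] at hS
    exact ⟨_, _, key _ _ hS, Subtype.ext (cutSet_hi_lo a b).symm⟩

/-- If p < p', a point between p and the smaller of q and p' lies in the first set but not in the
second; likewise at the other end. -/
theorem cutSet_inj {p q p' q' : Cut} (h : p < q) (h' : p' < q') (he : cutSet p q = cutSet p' q') :
    p = p' ∧ q = q' := by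
  have key : ∀ {p q p' q' : Cut}, p < q → p' < q' → cutSet p q ⊆ cutSet p' q' →
      p' ≤ p ∧ q ≤ q' := by
    intro p q p' q' h h' hs
    constructor
    · by_contra! hc
      obtain ⟨x, h₁, h₂⟩ := exists_between_cuts (lt_min h hc)
      have := (hs (show x ∈ cutSet p q from ⟨h₁, h₂.trans (min_le_left _ _)⟩)).1
      exact absurd ((h₂.trans (min_le_right _ _)).trans this) (not_le.2 (lo_lt_hi_self x))
    · by_contra! hc
      obtain ⟨x, h₁, h₂⟩ := exists_between_cuts (max_lt h hc)
      have := (hs (show x ∈ cutSet p q from ⟨(le_max_left _ _).trans h₁, h₂⟩)).2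
      exact absurd (this.trans ((le_max_right _ _).trans h₁)) (not_le.2 (lo_lt_hi_self x))
  have h₁ := key h h' he.le
  have h₂ := key h' h he.ge
  exact ⟨le_antisymm h₂.1 h₁.1, le_antisymm h₁.2 h₂.2⟩

/-! ### `Ext¹` between interval representations -/

/-- Two pairs cross if the second starts strictly later, but with no space in between, and
ends strictly later than the first. -/
def Crosses {C : Type*} [LinearOrder C] (p q p' q' : C) : Prop := p < p' ∧ p' ≤ q ∧ q < q'

section Ext

variable {k : Type u} [Field k]

/-- A lift of the generator at x₀ determines everything. To the right it is pushed forward, and it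
must vanish past S. To the left, bijectivity on the kernel gives a unique preimage over each
generator, and uniqueness makes these preimages compatible. -/
theorem exists_lift_of_base {S : Interval} {X : ShortComplex (Rep k)} (hX : X.ShortExact)
    (g : intervalRep k S ⟶ X.X₃) {x₀ : unitInterval} (hx₀ : x₀ ∈ S.1)
    (hbij : ∀ x ∈ S.1, ∀ h : x ≤ x₀, Function.Bijective (tr X.X₁ h))
    (hw : ∃ w : X.X₂.obj x₀, cmp X.g x₀ w = cmp g x₀ (one k S x₀) ∧
      ∀ y (h : x₀ ≤ y), y ∉ S.1 → tr X.X₂ h w = 0) :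
    ∃ g' : intervalRep k S ⟶ X.X₂, g' ≫ X.g = g := by
  have hm : Mono X.f := hX.mono_f
  have he : Epi X.g := hX.epi_g
  have hfg : ∀ x v, cmp X.g x (cmp X.f x v) = 0 := fun x v => by
    rw [← cmp_comp, X.zero]; rfl
  obtain ⟨w₀, hw₀, hz⟩ := hw
  have hex : ∀ x ∈ S.1, ∀ h : x ≤ x₀, ∃ w : X.X₂.obj x,
      cmp X.g x w = cmp g x (one k S x) ∧ tr X.X₂ h w = w₀ := by
    intro x hx h
    obtain ⟨w, hw⟩ := surjective_of_epi X.g x (cmp g x (one k S x))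
    obtain ⟨t, ht⟩ := exact_apply hX x₀ (w := tr X.X₂ h w - w₀) (by
      rw [map_sub, cmp_tr, hw, hw₀, ← cmp_tr, tr_one h hx, sub_self])
    obtain ⟨t, rfl⟩ := (hbij x hx h).2 t
    refine ⟨w - cmp X.f x t, ?_, ?_⟩
    · rw [map_sub, hfg, hw, sub_zero]
    · rw [map_sub, ← cmp_tr, ht, sub_sub_cancel]
  have huniq : ∀ x ∈ S.1, ∀ h : x ≤ x₀, ∀ w w' : X.X₂.obj x, cmp X.g x w = cmp X.g x w' →
      tr X.X₂ h w = tr X.X₂ h w' → w = w' := by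
    intro x hx h w w' h₁ h₂
    obtain ⟨t, ht⟩ := exact_apply hX x (w := w - w') (by rw [map_sub, h₁, sub_self])
    have : t = 0 := by
      apply (hbij x hx h).1
      apply injective_of_mono X.f x₀
      rw [cmp_tr, ht, map_sub, h₂, sub_self, map_zero, map_zero]
    rw [this, map_zero] at ht
    exact (sub_eq_zero.1 ht.symm)
  choose b hb₁ hb₂ using hex
  classical
  let a : ∀ x, x ∈ S.1 → X.X₂.obj x := fun x hx =>
    if h : x ≤ x₀ then b x hx h else tr X.X₂ (not_le.1 h).le w₀
  have ha : ∀ x hx, (∀ h : x ≤ x₀, a x hx = b x hx h) ∧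
      ∀ h : x₀ ≤ x, a x hx = tr X.X₂ h w₀ := by
    intro x hx
    refine ⟨fun h => by simp [a, h], fun h => ?_⟩
    by_cases h' : x ≤ x₀
    · obtain rfl := le_antisymm h h'
      rw [tr_self, show a x₀ hx = b x₀ hx h' by simp [a], ← hb₂ x₀ hx h', tr_self]
    · simp [a, h']
  have hag : ∀ x hx, cmp X.g x (a x hx) = cmp g x (one k S x) := by
    intro x hx
    rcases le_total x x₀ with h | h
    · rw [(ha x hx).1 h, hb₁]
    · rw [(ha x hx).2 h, cmp_tr, hw₀, ← cmp_tr, tr_one h hx₀]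
  have htr : ∀ x hx y (hxy : x ≤ y) (h : x₀ ≤ y), tr X.X₂ hxy (a x hx) = tr X.X₂ h w₀ := by
    intro x hx y hxy h
    rcases le_total x x₀ with h' | h'
    · rw [(ha x hx).1 h', ← tr_tr X.X₂ h' h, hb₂]
    · rw [(ha x hx).2 h', tr_tr]
  refine ⟨homOfFamily a ?_ ?_, ?_⟩
  · intro x y hxy hx hy
    rcases le_total y x₀ with h | h
    · refine huniq y hy h _ _ ?_ ?_
      · rw [cmp_tr, hag, hag, ← cmp_tr, tr_one hxy hx]
      · rw [tr_tr, htr x hx x₀ (hxy.trans h) le_rfl, htr y hy x₀ h le_rfl]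
    · rw [htr x hx y hxy h, (ha y hy).2 h]
  · intro x y hxy hx hy
    have h : x₀ ≤ y := by
      by_contra! hc
      exact hy (S.ordConnected.out hx hx₀ ⟨hxy, hc.le⟩)
    rw [htr x hx y hxy h, hz y h hy]
  · refine hom_ext_one fun x hx => ?_
    rw [cmp_comp, cmp_homOfFamily hx, hag]

theorem tr_bijective {S : Interval} {x y : unitInterval} (h : x ≤ y) (hs : x ∈ S.1 ↔ y ∈ S.1) :
    Function.Bijective (tr (intervalRep k S) h) := by
  by_cases hx : x ∈ S.1
  · have hy := hs.1 hx
    refine ⟨fun v w hvw => ?_, fun v => ⟨coord hy v • one k S x, ?_⟩⟩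
    · rw [eq_coord_smul hx v, eq_coord_smul hx w, ← coord_tr h hx hy, ← coord_tr h hx hy, hvw]
    · rw [map_smul, tr_one h hx, ← eq_coord_smul hy]
  · have hy := fun h => hx (hs.2 h)
    refine ⟨fun v w _ => ?_, fun v => ⟨0, ?_⟩⟩
    · rw [eq_zero_of_notMem hx v, eq_zero_of_notMem hx w]
    · rw [eq_zero_of_notMem hy v, map_zero]

/-- Write S and T for the two intervals. The base point x₀ is chosen so that the transition maps of
the kernel T up to x₀ are bijective on S: identities if x₀ lies in both, zero spaces if T has not
started yet or misses S. -/
theorem subsingleton_ext_of_not_crosses {p q p' q' : Cut} (h : p < q) (h' : p' < q')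
    (hc : ¬ Crosses p q p' q') :
    Subsingleton (Abelian.Ext.{u + 1} (intervalRep k (itv h)) (intervalRep k (itv h')) 1) := by
  refine subsingleton_ext_one fun X₂ X₃ f e hfe hX g => ?_
  have hm : Mono f := hX.mono_f
  have he : Epi e := hX.epi_g
  have hfg : ∀ x v, cmp e x (cmp f x v) = 0 := fun x v => by
    rw [← cmp_comp, hfe]; rfl
  by_cases hA : p' ≤ p ∧ ∃ x, x ∈ (itv h).1 ∧ x ∈ (itv h').1
  · obtain ⟨hpp, x₀, hx₀, hx₀'⟩ := hA
    refine exists_lift_of_base hX g hx₀ ?_ ?_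
    · intro x hx hxx
      exact tr_bijective hxx ⟨fun _ => hx₀', fun _ => ⟨hpp.trans hx.1,
        (hi_le_hi.2 hxx).trans hx₀'.2⟩⟩
    · obtain ⟨w, hw⟩ := surjective_of_epi e x₀ (cmp g x₀ (one k _ x₀))
      have hker : ∀ y (hy : x₀ ≤ y), y ∉ (itv h).1 → ∃ t, cmp f y t = tr X₂ hy w := by
        intro y hy hyS
        refine exact_apply hX y (w := tr X₂ hy w) ?_
        change cmp e y _ = 0
        rw [cmp_tr, hw, ← cmp_tr, eq_zero_of_notMem hyS (tr _ hy _), map_zero]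
      -- If T outlives S, the error of w at a point y₀ past S comes from the kernel and can be
      -- pulled back to x₀. Subtracting it makes w vanish at y₀, hence at every point past S.
      by_cases hy₀ : ∃ y, x₀ ≤ y ∧ y ∉ (itv h).1 ∧ y ∈ (itv h').1
      · obtain ⟨y₀, hxy, hyS, hyT⟩ := hy₀
        obtain ⟨t, ht⟩ := hker y₀ hxy hyS
        obtain ⟨t, rfl⟩ := (tr_bijective (k := k) (S := itv h') hxy (iff_of_true hx₀' hyT)).2 t
        have hw' : tr X₂ hxy (w - cmp f x₀ t) = 0 := by
          rw [map_sub, ← cmp_tr, ht, sub_self]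
        refine ⟨w - cmp f x₀ t, ?_, ?_⟩
        · change cmp e _ _ = _
          rw [map_sub, hfg, sub_zero, hw]
        · intro y hy hyS'
          obtain ⟨s, hs⟩ := hker y hy hyS'
          by_cases hyT' : y ∈ (itv h').1
          · rcases le_total y₀ y with hyy | hyy
            · change tr X₂ hy _ = 0
              rw [← tr_tr X₂ hxy hyy, hw', map_zero]
            · have hs' : tr X₂ hy (w - cmp f x₀ t) = cmp f y (s - tr _ hy t) := by
                rw [map_sub, map_sub, hs, cmp_tr]
              change tr X₂ hy _ = 0
              rw [hs']
              have : s - tr (intervalRep k (itv h')) hy t = 0 := by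
                apply (tr_bijective (k := k) (S := itv h') hyy (iff_of_true hyT' hyT)).1
                apply injective_of_mono f y₀
                rw [cmp_tr, ← hs', tr_tr, hw', map_zero, map_zero]
              rw [this, map_zero]
          · change tr X₂ hy _ = 0
            rw [map_sub, ← hs, eq_zero_of_notMem hyT' s, map_zero, zero_sub, ← cmp_tr,
              eq_zero_of_notMem hyT' (tr _ hy t), map_zero, neg_zero]
      · refine ⟨w, hw, fun y hy hyS => ?_⟩
        obtain ⟨t, ht⟩ := hker y hy hyS
        change tr X₂ hy w = 0
        rw [← ht, eq_zero_of_notMem (fun hyT => hy₀ ⟨y, hy, hyS, hyT⟩) t, map_zero]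
  · obtain ⟨x₀, hx₀, hlow, hgap⟩ : ∃ x₀ ∈ (itv h).1, (∀ x ∈ (itv h).1, x ≤ x₀ → x ∉ (itv h').1) ∧
        ∀ y, x₀ ≤ y → y ∉ (itv h).1 → y ∈ (itv h').1 →
          ∃ z, x₀ ≤ z ∧ z ≤ y ∧ z ∉ (itv h).1 ∧ z ∉ (itv h').1 := by
      rcases le_or_gt p' p with hpp | hpp
      · obtain ⟨x₀, hx₀⟩ := exists_between_cuts h
        have hdisj : ∀ x ∈ (itv h).1, x ∉ (itv h').1 := fun x h₁ h₂ => hA ⟨hpp, x, h₁, h₂⟩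
        exact ⟨x₀, hx₀, fun x hx _ => hdisj x hx, fun y hy _ hyT => absurd
          (show x₀ ∈ (itv h').1 from ⟨hpp.trans hx₀.1, (hi_le_hi.2 hy).trans hyT.2⟩)
          (hdisj x₀ hx₀)⟩
      · obtain ⟨x₀, h₁, h₂⟩ := exists_between_cuts (lt_min h hpp)
        refine ⟨x₀, ⟨h₁, h₂.trans (min_le_left _ _)⟩, fun x _ hxx hxT => ?_, fun y hy hyS hyT => ?_⟩
        · exact absurd (((h₂.trans (min_le_right _ _)).trans hxT.1).trans (lo_le_lo.2 hxx))
            (not_le.2 (lo_lt_hi_self _))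
        · have hqy : q < hi y := not_le.1 fun hh => hyS ⟨h₁.trans (lo_le_lo.2 hy), hh⟩
          -- Noncrossing enters here: T starts strictly after S ends, and a point z between them,
          -- where the kernel is zero, forces w to vanish before T begins.
          have hqp : q < p' := by
            by_contra! hh
            exact hc ⟨hpp, hh, hqy.trans_le hyT.2⟩
          obtain ⟨z, hz₁, hz₂⟩ := exists_between_cuts hqp
          refine ⟨z, ?_, ?_, fun hz => ?_, fun hz => ?_⟩
          · exact lo_le_hi.1 (((lo_lt_hi_self _).le.trans (h₂.trans (min_le_left _ _))).trans
              (hz₁.trans (lo_lt_hi_self z).le))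
          · exact (hi_le_lo.1 (hz₂.trans hyT.1)).le
          · exact absurd (hz.2.trans hz₁) (not_le.2 (lo_lt_hi_self _))
          · exact absurd (hz₂.trans hz.1) (not_le.2 (lo_lt_hi_self _))
    refine exists_lift_of_base hX g hx₀ ?_ ?_
    · intro x hx hxx
      exact tr_bijective hxx (iff_of_false (hlow x hx hxx) (hlow x₀ hx₀ le_rfl))
    · obtain ⟨w, hw⟩ := surjective_of_epi e x₀ (cmp g x₀ (one k _ x₀))
      have hker : ∀ y (hy : x₀ ≤ y), y ∉ (itv h).1 → ∃ t, cmp f y t = tr X₂ hy w := by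
        intro y hy hyS
        refine exact_apply hX y (w := tr X₂ hy w) ?_
        change cmp e y _ = 0
        rw [cmp_tr, hw, ← cmp_tr, eq_zero_of_notMem hyS (tr _ hy _), map_zero]
      have hker' : ∀ y (hy : x₀ ≤ y), y ∉ (itv h).1 → y ∉ (itv h').1 → tr X₂ hy w = 0 := by
        intro y hy hyS hyT
        obtain ⟨t, ht⟩ := hker y hy hyS
        rw [← ht, eq_zero_of_notMem hyT t, map_zero]
      refine ⟨w, hw, fun y hy hyS => ?_⟩
      change tr X₂ hy w = 0
      by_cases hyT : y ∈ (itv h').1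
      · obtain ⟨z, h₁, h₂, h₃, h₄⟩ := hgap y hy hyS hyT
        rw [← tr_tr X₂ h₁ h₂, hker' z h₁ h₃ h₄, map_zero]
      · exact hker' y hy hyS hyT

/-- The canonical morphism between two interval representations. -/
noncomputable def canHom {S T : Interval}
    (H : ∀ x y, x ≤ y → x ∈ S.1 → y ∈ T.1 → (y ∈ S.1 ↔ x ∈ T.1)) :
    intervalRep k S ⟶ intervalRep k T :=
  homOfFamily (fun x _ => one k T x) (by
      intro x y hxy hx hy
      by_cases hyT : y ∈ T.1
      · exact tr_one hxy ((H x y hxy hx hyT).1 hy)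
      · rw [eq_zero_of_notMem hyT (one k T y), eq_zero_of_notMem hyT (tr _ hxy _)]) (by
      intro x y hxy hx hy
      by_cases hyT : y ∈ T.1
      · exact tr_eq_zero_of_notMem hxy (fun h => hy ((H x y hxy hx hyT).2 h)) _
      · exact eq_zero_of_notMem hyT _)

theorem cmp_canHom {S T : Interval}
    (H : ∀ x y, x ≤ y → x ∈ S.1 → y ∈ T.1 → (y ∈ S.1 ↔ x ∈ T.1)) {x : unitInterval}
    (hx : x ∈ S.1) : cmp (canHom (k := k) H) x (one k S x) = one k T x :=
  cmp_homOfFamily hx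

theorem one_ne_zero_of_mem {S : Interval} {x : unitInterval} (hx : x ∈ S.1) : one k S x ≠ 0 := by
  intro h
  have := congrArg (coord hx) h
  rw [coord_one, map_zero] at this
  exact one_ne_zero this

/-- Let U be the interval from p to q'. A lift S → U of S → U/T is forced to be the identity at a
point x between p and p', where T vanishes. At a point y between q and q' the generator of S has
died while that of U has not, a contradiction. -/
theorem not_subsingleton_ext_of_crosses {p q p' q' : Cut} (h : p < q) (h' : p' < q')
    (hc : Crosses p q p' q') :
    ¬ Subsingleton (Abelian.Ext.{u + 1} (intervalRep k (itv h)) (intervalRep k (itv h')) 1) := by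
  intro hs
  obtain ⟨hpp, hpq, hqq⟩ := hc
  have hU : p < q' := hpp.trans h'
  let f : intervalRep k (itv h') ⟶ intervalRep k (itv hU) := canHom (by
    intro x y hxy hx hy
    exact iff_of_true ⟨hx.1.trans (lo_le_lo.2 hxy), hy.2⟩ ⟨hpp.le.trans hx.1, hx.2⟩)
  have hf : ∀ x ∈ (itv h').1, cmp f x (one k _ x) = one k _ x := fun x hx => cmp_canHom _ hx
  have hm : Mono f := by
    refine mono_of_injective f fun x => (injective_iff_map_eq_zero _).2 fun v hv => ?_
    by_cases hx : x ∈ (itv h').1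
    · have hx' : x ∈ (itv hU).1 := ⟨hpp.le.trans hx.1, hx.2⟩
      rw [eq_coord_smul hx v, map_smul, hf x hx, smul_eq_zero] at hv
      rw [eq_coord_smul hx v, hv.resolve_right (one_ne_zero_of_mem hx'), zero_smul]
    · exact eq_zero_of_notMem hx v
  let X : ShortComplex (Rep k) := ShortComplex.mk f (cokernel.π f) (cokernel.condition f)
  have hX : X.ShortExact :=
    { exact := ShortComplex.exact_of_g_is_cokernel _ (cokernelIsCokernel f)
      mono_f := hm
      epi_g := inferInstanceAs (Epi (cokernel.π f)) }
  let g : intervalRep k (itv h) ⟶ X.X₃ :=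
    homOfFamily (fun x _ => cmp (cokernel.π f) x (one k (itv hU) x)) (by
      intro x y hxy hx hy
      have hx' : x ∈ (itv hU).1 := ⟨hx.1, hx.2.trans hqq.le⟩
      change tr (cokernel f) hxy _ = _
      rw [← cmp_tr, tr_one hxy hx']) (by
      intro x y hxy hx hy
      have hx' : x ∈ (itv hU).1 := ⟨hx.1, hx.2.trans hqq.le⟩
      change tr (cokernel f) hxy _ = _
      rw [← cmp_tr, tr_one hxy hx']
      by_cases hyU : y ∈ (itv hU).1
      · have hq : q ≤ lo y := (le_lo_or_hi_le q y).resolve_right fun hh => hy ⟨hyU.1, hh⟩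
        rw [← hf y ⟨hpq.trans hq, hyU.2⟩, ← cmp_comp, cokernel.condition]
        rfl
      · rw [eq_zero_of_notMem hyU (one k _ y), map_zero])
  obtain ⟨g', hg'⟩ := exists_lift_of_subsingleton_ext hX hs g
  obtain ⟨x, hx₁, hx₂⟩ := exists_between_cuts hpp
  obtain ⟨y, hy₁, hy₂⟩ := exists_between_cuts hqq
  have hx : x ∈ (itv h).1 := ⟨hx₁, hx₂.trans hpq⟩
  have hxU : x ∈ (itv hU).1 := ⟨hx₁, hx₂.trans h'.le⟩
  have hyU : y ∈ (itv hU).1 := ⟨h.le.trans hy₁, hy₂⟩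
  have hyS : y ∉ (itv h).1 := fun hh => absurd (hh.2.trans hy₁) (not_le.2 (lo_lt_hi_self y))
  have hxy : x ≤ y := (hi_le_lo.1 ((hx₂.trans hpq).trans hy₁)).le
  have hlift : cmp g' x (one k _ x) = one k (itv hU) x := by
    obtain ⟨t, ht⟩ := exact_apply hX x (w := cmp g' x (one k _ x) - one k (itv hU) x) (by
      have : cmp X.g x (cmp g' x (one k _ x)) = cmp X.g x (one k (itv hU) x) := by
        rw [← cmp_comp, hg']
        exact cmp_homOfFamily hx
      exact (map_sub (cmp X.g x) _ _).trans (sub_eq_zero.2 this))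
    have hxT : x ∉ (itv h').1 := fun hh => absurd (hx₂.trans hh.1) (not_le.2 (lo_lt_hi_self x))
    have ht0 : t = 0 := eq_zero_of_notMem hxT t
    rw [ht0, map_zero] at ht
    exact (sub_eq_zero.1 ht.symm)
  refine one_ne_zero_of_mem (k := k) hyU ?_
  rw [← tr_one hxy hxU, ← hlift]
  have := cmp_tr g' hxy (one k (itv h) x)
  rw [eq_zero_of_notMem hyS (tr _ hxy _), map_zero] at this
  exact this.symm

theorem subsingleton_ext_iff {p q p' q' : Cut} (h : p < q) (h' : p' < q') :
    Subsingleton (Abelian.Ext.{u + 1} (intervalRep k (itv h)) (intervalRep k (itv h')) 1) ↔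
      ¬ Crosses p q p' q' :=
  ⟨fun hs hc => not_subsingleton_ext_of_crosses h h' hc hs, subsingleton_ext_of_not_crosses h h'⟩

end Ext

/-! ### Interval summands of a representation -/

section KrullSchmidt

variable {k : Type u} [Field k]

/-- Evaluation at x preserves coproducts, so the quotient map by the sum of the ranges is zero
because it vanishes on each summand. -/
theorem mem_iSup_range_ι {L : Type u} (M : L → Rep k) (x : unitInterval) (z : (∐ M).obj x) :
    z ∈ ⨆ l, LinearMap.range (cmp (Sigma.ι M l) x) := by
  set p := ⨆ l, LinearMap.range (cmp (Sigma.ι M l) x) with hp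
  have hc := isColimitOfPreserves ((evaluation unitInterval (ModuleCat.{u} k)).obj x)
    (colimit.isColimit (Discrete.functor M))
  have h0 : ModuleCat.ofHom p.mkQ = (0 : (∐ M).obj x ⟶ ModuleCat.of k (_ ⧸ p)) := by
    refine hc.hom_ext fun j => ?_
    ext v
    have : cmp (Sigma.ι M j.as) x v ∈ p :=
      Submodule.mem_iSup_of_mem j.as (LinearMap.mem_range_self _ v)
    exact (Submodule.Quotient.mk_eq_zero p).2 this
  have := congrArg (fun φ => φ.hom z) h0
  exact (Submodule.Quotient.mk_eq_zero p).1 this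

open Classical in
theorem exists_sum_ι_π {L : Type u} (M : L → Rep k) (x : unitInterval) (z : (∐ M).obj x) :
    ∃ F : Finset L, z = ∑ l ∈ F, cmp (Sigma.π M l ≫ Sigma.ι M l) x z := by
  -- Allowing every larger finite set lets the induction treat a sum of two vectors through the
  -- union of their index sets.
  suffices h : ∃ F : Finset L, ∀ F', F ⊆ F' →
      z = ∑ l ∈ F', cmp (Sigma.π M l ≫ Sigma.ι M l) x z by
    obtain ⟨F, hF⟩ := h
    exact ⟨F, hF F subset_rfl⟩
  refine Submodule.iSup_induction _ (motive := fun z => ∃ F : Finset L, ∀ F', F ⊆ F' →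
      z = ∑ l ∈ F', cmp (Sigma.π M l ≫ Sigma.ι M l) x z) (mem_iSup_range_ι M x z) ?_ ?_ ?_
  · rintro j _ ⟨v, rfl⟩
    refine ⟨{j}, fun F' hF' => ?_⟩
    rw [Finset.sum_eq_single j]
    · rw [← cmp_comp, Sigma.ι_π_eq_id_assoc]
    · intro l _ hl
      rw [← cmp_comp, Sigma.ι_π_of_ne_assoc _ hl.symm, zero_comp]
      rfl
    · intro hj
      exact absurd (hF' (Finset.mem_singleton_self j)) hj
  · exact ⟨∅, fun F' _ => by simp⟩
  · rintro v w ⟨F, hF⟩ ⟨G, hG⟩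
    refine ⟨F ∪ G, fun F' hF' => ?_⟩
    simp only [map_add, Finset.sum_add_distrib]
    rw [← hF F' (Finset.union_subset_left hF'), ← hG F' (Finset.union_subset_right hF')]

/-- Endomorphisms of an interval representation are scalars: naturality transports the coefficient
along S. -/
theorem coord_cmp_eq {S : Interval} (f : intervalRep k S ⟶ intervalRep k S) {x y : unitInterval}
    (hx : x ∈ S.1) (hy : y ∈ S.1) :
    coord hx (cmp f x (one k S x)) = coord hy (cmp f y (one k S y)) := by
  have key : ∀ {x y : unitInterval} (hx : x ∈ S.1) (hy : y ∈ S.1), x ≤ y →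
      coord hx (cmp f x (one k S x)) = coord hy (cmp f y (one k S y)) := by
    intro x y hx hy hxy
    rw [← tr_one hxy hx, cmp_tr, coord_tr hxy hx hy]
  rcases le_total x y with h | h
  · exact key hx hy h
  · exact (key hy hx h).symm

-- The identity of T_S is, at one point, a finite sum of scalars coming from endomorphisms through
-- the M l. One of these scalars is nonzero, and its inverse normalizes that factorization to a
-- retract.
open Classical in
theorem exists_retract_of_retract_sigma {S : Interval} {L : Type u} {M : L → Rep k}
    (R : Retract (intervalRep k S) (∐ M)) : ∃ l, Nonempty (Retract (intervalRep k S) (M l)) := by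
  obtain ⟨x, hx⟩ := S.2.1
  obtain ⟨F, hF⟩ := exists_sum_ι_π M x (cmp R.i x (one k S x))
  have h1 : ∑ l ∈ F, coord hx (cmp (R.i ≫ Sigma.π M l ≫ Sigma.ι M l ≫ R.r) x (one k S x)) = 1 := by
    have h2 : cmp R.r x (cmp R.i x (one k S x)) = one k S x := by
      rw [← cmp_comp, R.retract, cmp_id]
    rw [hF, map_sum] at h2
    have h3 := congrArg (coord hx) h2
    rw [map_sum, coord_one] at h3
    rw [← h3]
    refine Finset.sum_congr rfl fun l _ => ?_
    simp only [cmp_comp]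
  obtain ⟨l, -, hl⟩ := Finset.exists_ne_zero_of_sum_ne_zero (h1.trans_ne one_ne_zero)
  set c := coord hx (cmp (R.i ≫ Sigma.π M l ≫ Sigma.ι M l ≫ R.r) x (one k S x)) with hc
  refine ⟨l, ⟨⟨c⁻¹ • (R.i ≫ Sigma.π M l), Sigma.ι M l ≫ R.r, ?_⟩⟩⟩
  refine hom_ext_one fun y hy => ?_
  rw [Linear.smul_comp, cmp_id]
  change c⁻¹ • cmp ((R.i ≫ Sigma.π M l) ≫ Sigma.ι M l ≫ R.r) y (one k S y) = _
  rw [Category.assoc, eq_coord_smul hy (cmp _ y _), ← coord_cmp_eq _ hx hy, ← hc, smul_smul,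
    inv_mul_cancel₀ hl, one_smul]

/-- The inclusion S ⊆ T is clear pointwise. At a point of T outside S the idempotent `R.r ≫ R.i` is
zero; being a scalar, it is zero everywhere, although it fixes the image of S. -/
theorem eq_of_retract {S T : Interval} (R : Retract (intervalRep k S) (intervalRep k T)) :
    S = T := by
  have hST : ∀ {x}, x ∈ S.1 → x ∈ T.1 := by
    intro x hx
    by_contra hxT
    refine one_ne_zero_of_mem (k := k) hx ?_
    rw [← cmp_id (intervalRep k S) x (one k S x), ← R.retract, cmp_comp,
      eq_zero_of_notMem hxT (cmp R.i x _), map_zero]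
  refine Subtype.ext (Set.Subset.antisymm (fun x hx => hST hx) fun y hy => ?_)
  obtain ⟨x, hx⟩ := S.2.1
  by_contra hyS
  have h1 : coord (hST hx) (cmp (R.r ≫ R.i) x (one k T x)) = 0 := by
    rw [coord_cmp_eq _ (hST hx) hy, cmp_comp, eq_zero_of_notMem hyS (cmp R.r y _), map_zero,
      map_zero]
  have h2 : cmp (R.r ≫ R.i) x (one k T x) = 0 := by
    rw [eq_coord_smul (hST hx) (cmp _ x _), h1, zero_smul]
  have h3 : ∀ v, cmp (R.r ≫ R.i) x v = 0 := fun v => by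
    rw [eq_coord_smul (hST hx) v, map_smul, h2, smul_zero]
  refine one_ne_zero_of_mem (k := k) hx ?_
  have h4 := h3 (cmp R.i x (one k S x))
  have h5 : cmp R.r x (cmp R.i x (one k S x)) = one k S x := by
    rw [← cmp_comp, R.retract, cmp_id]
  rw [cmp_comp, h5] at h4
  rw [← h5, h4, map_zero]

/-- The intervals whose representations are direct summands of `M`. -/
def supp (M : Rep k) : Set Interval := {S | Nonempty (Retract (intervalRep k S) M)}

theorem supp_congr {M N : Rep k} (e : M ≅ N) : supp M = supp N := by
  ext S
  exact ⟨fun ⟨R⟩ => ⟨R.trans (Retract.ofIso e)⟩, fun ⟨R⟩ => ⟨R.trans (Retract.ofIso e.symm)⟩⟩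

theorem supp_sigma {L : Type u} (M : L → Rep k) : supp (∐ M) = ⋃ l, supp (M l) := by
  classical
  ext S
  rw [Set.mem_iUnion]
  refine ⟨fun ⟨R⟩ => exists_retract_of_retract_sigma R, fun ⟨l, ⟨R⟩⟩ => ⟨R.trans ?_⟩⟩
  exact ⟨Sigma.ι M l, Sigma.π M l, Sigma.ι_π_eq_id _ _⟩

theorem supp_intervalRep (S : Interval) : supp (intervalRep k S) = {S} := by
  ext T
  refine ⟨fun ⟨R⟩ => eq_of_retract R, ?_⟩
  rintro rfl
  exact ⟨Retract.ofIso (Iso.refl _)⟩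

/-- Krull–Schmidt up to multiplicities. It makes all notions defined through some decomposition
independent of the choice. -/
theorem Decomposition.range_S {M : Rep k} (D : Decomposition M) : Set.range D.S = supp M := by
  rw [supp_congr D.iso, supp_sigma]
  ext S
  simp [supp_intervalRep, eq_comm]

theorem Decomposition.intervals_eq {M : Rep k} (D : Decomposition M) :
    D.intervals = Subtype.val '' supp M := by
  rw [← D.range_S]
  exact Set.range_comp Subtype.val D.S

theorem isBasic_iff {M : Rep k} :
    IsBasic M ↔ ∃ D : Decomposition M, Function.Injective D.S := by
  refine exists_congr fun D => ⟨fun h i j hij => ?_, fun h i j hij => ⟨fun e => hij (h ?_)⟩⟩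
  · by_contra hne
    exact (h i j hne).false (eqToIso (congrArg (intervalRep k) hij))
  · exact eq_of_retract (Retract.ofIso e)

/-- `Ext¹` vanishes between the interval representations of a set of intervals. -/
def RigidSet (k : Type u) [Field k] (X : Set Interval) : Prop :=
  ∀ S ∈ X, ∀ T ∈ X, Subsingleton (Abelian.Ext.{u + 1} (intervalRep k S) (intervalRep k T) 1)

theorem Decomposition.isRigid_iff {M : Rep k} (D : Decomposition M) :
    IsRigid M ↔ RigidSet k (supp M) := by
  have key : ∀ D : Decomposition M, (∀ i j : D.I,
      Subsingleton (Abelian.Ext.{u + 1} (D.summand i) (D.summand j) 1)) ↔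
        RigidSet k (supp M) := by
    intro D
    rw [← D.range_S, RigidSet, Set.forall_mem_range]
    simp only [Set.forall_mem_range]
    rfl
  exact ⟨fun ⟨D', h⟩ => (key D').1 h, fun h => ⟨D, (key D).2 h⟩⟩

/-- A biproduct of coproducts is a coproduct over the sum of the index types. -/
noncomputable def biprodSigmaIso {C : Type*} [Category C] [Preadditive C] [HasBinaryBiproducts C]
    {I J : Type*} (h : I ⊕ J → C) [HasCoproduct h] [HasCoproduct fun i => h (Sum.inl i)]
    [HasCoproduct fun j => h (Sum.inr j)] :
    (∐ fun i => h (Sum.inl i)) ⊞ (∐ fun j => h (Sum.inr j)) ≅ ∐ h where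
  hom := biprod.desc (Sigma.desc fun i => Sigma.ι h (Sum.inl i))
    (Sigma.desc fun j => Sigma.ι h (Sum.inr j))
  inv := Sigma.desc (Sum.rec (fun i => Sigma.ι (fun i => h (Sum.inl i)) i ≫ biprod.inl)
    (fun j => Sigma.ι (fun j => h (Sum.inr j)) j ≫ biprod.inr))
  hom_inv_id := by
    refine biprod.hom_ext' _ _ ?_ ?_ <;> refine Sigma.hom_ext _ _ fun i => ?_ <;> simp
  inv_hom_id := by
    refine Sigma.hom_ext _ _ fun j => ?_
    cases j <;> simp

/-- The decomposition of a biproduct. -/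
noncomputable def Decomposition.biprod {M N : Rep k} (D : Decomposition M) (D' : Decomposition N) :
    Decomposition (M ⊞ N) where
  I := D.I ⊕ D'.I
  S := Sum.elim D.S D'.S
  iso := biprod.mapIso D.iso D'.iso ≪≫
    biprodSigmaIso (fun j => intervalRep k (Sum.elim D.S D'.S j))

theorem supp_biprod {M N : Rep k} (D : Decomposition M) (D' : Decomposition N) :
    supp (M ⊞ N) = supp M ∪ supp N := by
  rw [← (D.biprod D').range_S, ← D.range_S, ← D'.range_S]
  exact Set.Sum.elim_range _ _

/-- For the converse, one copy of M for each summand of N is enough. -/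
theorem Decomposition.inAdd_iff {M N : Rep k} (D : Decomposition N) :
    InAdd N M ↔ supp N ⊆ supp M := by
  constructor
  · rintro ⟨L, ⟨R⟩⟩ S ⟨R'⟩
    obtain ⟨_, h⟩ := exists_retract_of_retract_sigma (R'.trans R)
    exact h
  · intro h
    have hR : ∀ i, Nonempty (Retract (intervalRep k (D.S i)) M) := fun i =>
      h (D.range_S ▸ Set.mem_range_self i)
    refine ⟨D.I, ⟨(Retract.ofIso D.iso).trans ⟨Limits.Sigma.map fun i => (hR i).some.i,
      Limits.Sigma.map fun i => (hR i).some.r, ?_⟩⟩⟩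
    refine Sigma.hom_ext _ _ fun i => ?_
    simp

/-- The decomposition of an interval representation. -/
noncomputable def decompositionIntervalRep (S : Interval) : Decomposition (intervalRep k S) where
  I := PUnit
  S := fun _ => S
  iso := (coproductUniqueIso fun _ : PUnit.{u + 1} => intervalRep k S).symm

/-- Maximality may be tested on a single interval: if M ⊞ N is rigid, so is M with any one summand
of N added. -/
theorem isMaximalRigid_iff {M : Rep k} : IsMaximalRigid M ↔
    IsBasic M ∧ RigidSet k (supp M) ∧ ∀ S, RigidSet k (insert S (supp M)) → S ∈ supp M := by
  constructor
  · rintro ⟨hb, hr, hm⟩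
    obtain ⟨D, -⟩ := id hb
    refine ⟨hb, D.isRigid_iff.1 hr, fun S hS => ?_⟩
    have h := hm (intervalRep k S) ⟨decompositionIntervalRep S⟩ (by
      rw [(D.biprod (decompositionIntervalRep S)).isRigid_iff,
        supp_biprod D (decompositionIntervalRep S), supp_intervalRep, Set.union_singleton]
      exact hS)
    rw [(decompositionIntervalRep S).inAdd_iff, supp_intervalRep, Set.singleton_subset_iff] at h
    exact h
  · rintro ⟨hb, hr, hm⟩
    obtain ⟨D, -⟩ := id hb
    refine ⟨hb, D.isRigid_iff.2 hr, fun N ⟨D'⟩ hN => ?_⟩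
    rw [(D.biprod D').isRigid_iff, supp_biprod D D'] at hN
    rw [D'.inAdd_iff]
    intro S hS
    refine hm S fun T hT U hU => hN T ?_ U ?_
    · rcases hT with rfl | hT
      · exact Or.inr hS
      · exact Or.inl hT
    · rcases hU with rfl | hU
      · exact Or.inr hS
      · exact Or.inl hU

/-- The direct sum of the interval representations of a set of intervals. -/
noncomputable def repOfSet (k : Type u) [Field k] (X : Set Interval) : Rep k :=
  ∐ fun i : ULift.{u} X => intervalRep k i.down.1

/-- The defining decomposition of `repOfSet`. -/
noncomputable def decompositionRepOfSet (X : Set Interval) : Decomposition (repOfSet k X) where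
  I := ULift.{u} X
  S := fun i => i.down.1
  iso := Iso.refl _

theorem supp_repOfSet (X : Set Interval) : supp (repOfSet k X) = X := by
  rw [← (decompositionRepOfSet (k := k) X).range_S]
  ext S
  exact ⟨fun ⟨i, hi⟩ => hi ▸ i.down.2, fun h => ⟨⟨⟨S, h⟩⟩, rfl⟩⟩

theorem isBasic_repOfSet (X : Set Interval) : IsBasic (repOfSet k X) :=
  isBasic_iff.2 ⟨decompositionRepOfSet X, fun _ _ h => ULift.ext _ _ (Subtype.ext h)⟩

theorem IsBasic.nonempty_iso {M : Rep k} (h : IsBasic M) : Nonempty (M ≅ repOfSet k (supp M)) := by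
  obtain ⟨D, hD⟩ := isBasic_iff.1 h
  let e : D.I ≃ ULift.{u} (supp M) :=
    ((Equiv.ofInjective D.S hD).trans (Equiv.setCongr D.range_S)).trans Equiv.ulift.symm
  exact ⟨D.iso ≪≫ Sigma.whiskerEquiv (f := fun i => intervalRep k (D.S i))
    (g := fun i : ULift.{u} (supp M) => intervalRep k i.down.1) e fun i => Iso.refl _⟩

/-- The isomorphism classes of maximal rigid representations of type `α` correspond to the
maximal rigid sets of intervals of type `α`. -/
theorem maximalRigidClasses_eq_image {n : ℕ} (α : Fin (n + 1) → unitInterval) :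
    maximalRigidClasses k α = (fun X : Set Interval => Quotient.mk _ (repOfSet k X)) ''
      {X | RigidSet k X ∧ (∀ S, RigidSet k (insert S X) → S ∈ X) ∧
        IntervalsOfType α (Subtype.val '' X)} := by
  ext q
  constructor
  · rintro ⟨M, rfl, hM, D, hD⟩
    rw [isMaximalRigid_iff] at hM
    refine ⟨supp M, ⟨hM.2.1, hM.2.2, D.intervals_eq ▸ hD⟩, ?_⟩
    obtain ⟨e⟩ := hM.1.nonempty_iso
    exact Quotient.sound ⟨e.symm⟩
  · rintro ⟨X, ⟨h₁, h₂, h₃⟩, rfl⟩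
    refine ⟨_, rfl, isMaximalRigid_iff.2 ⟨isBasic_repOfSet X, ?_⟩, decompositionRepOfSet X, ?_⟩
    · rw [supp_repOfSet]
      exact ⟨h₁, h₂⟩
    · rw [Decomposition.intervals_eq, supp_repOfSet]
      exact h₃

theorem repOfSet_class_injective : Function.Injective
    (fun X : Set Interval => (Quotient.mk (isIsomorphicSetoid (Rep k)) (repOfSet k X))) := by
  intro X Y h
  obtain ⟨e⟩ := Quotient.exact h
  rw [← supp_repOfSet (k := k) X, supp_congr e, supp_repOfSet]

end KrullSchmidt

/-! ### Maximal noncrossing families of pairs, and binary trees -/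

/-- `X` is a maximal noncrossing family of pairs `p < q` with entries in `E`. -/
structure MaxNC {C : Type*} [LinearOrder C] (E : Set C) (X : C → C → Prop) : Prop where
  mem : ∀ {p q}, X p q → p ∈ E ∧ q ∈ E ∧ p < q
  nc : ∀ {p q p' q'}, X p q → X p' q' → ¬ Crosses p q p' q'
  max : ∀ {p q}, p ∈ E → q ∈ E → p < q →
    (∀ p' q', X p' q' → ¬ Crosses p q p' q' ∧ ¬ Crosses p' q' p q) → X p q

/-- The family of pairs encoded by a binary tree, with smallest entry `a`. -/
def treePairs : BinaryTree Unit → ℕ → ℕ → ℕ → Prop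
  | .nil, _, _, _ => False
  -- The root is the pair of extreme points. The subtrees live on consecutive blocks without a
  -- common point, since touching pairs already cross; a block of m+1 points carries m nodes.
  | .node _ l r, a, p, q => (p = a ∧ q = a + (l.numNodes + r.numNodes + 1)) ∨
      treePairs l a p q ∨ treePairs r (a + l.numNodes + 1) p q

theorem treePairs_bounds (t : BinaryTree Unit) : ∀ {a p q : ℕ}, treePairs t a p q →
    a ≤ p ∧ p < q ∧ q ≤ a + t.numNodes := by
  induction t with
  | nil => exact fun h => h.elim
  | node v l r hl hr =>
    rintro a p q (⟨rfl, rfl⟩ | h | h)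
    · simp only [BinaryTree.numNodes]; omega
    · have := hl h; simp only [BinaryTree.numNodes]; omega
    · have := hr h; simp only [BinaryTree.numNodes]; omega

theorem treePairs_root (t : BinaryTree Unit) (a : ℕ) (h : 0 < t.numNodes) :
    treePairs t a a (a + t.numNodes) := by
  cases t with
  | nil => simp at h
  | node v l r => exact Or.inl ⟨rfl, rfl⟩

theorem maxNC_treePairs (t : BinaryTree Unit) : ∀ a : ℕ,
    MaxNC (Set.Icc a (a + t.numNodes)) (treePairs t a) := by
  induction t with
  | nil =>
    intro a
    refine ⟨fun h => h.elim, fun h => h.elim, fun {p q} hp hq hpq => ?_⟩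
    simp only [BinaryTree.numNodes, Set.mem_Icc] at hp hq
    omega
  | node v l r hl hr =>
    intro a
    have bl := fun {p q} => treePairs_bounds l (a := a) (p := p) (q := q)
    have br := fun {p q} => treePairs_bounds r (a := a + l.numNodes + 1) (p := p) (q := q)
    refine ⟨fun {p q} h => ?_, fun {p q p' q'} h h' => ?_, fun {p q} hp hq hpq h => ?_⟩
    · have := treePairs_bounds _ h
      simp only [Set.mem_Icc]; omega
    · have b := treePairs_bounds _ h
      have b' := treePairs_bounds _ h'
      simp only [BinaryTree.numNodes] at b b'
      rcases h with h | h | h <;> rcases h' with h' | h' | h'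
      · simp only [Crosses]; omega
      · simp only [Crosses]; omega
      · simp only [Crosses]; omega
      · simp only [Crosses]; omega
      · exact (hl a).nc h h'
      · have := bl h; have := br h'; simp only [Crosses]; omega
      · simp only [Crosses]; omega
      · have := br h; have := bl h'; simp only [Crosses]; omega
      · exact (hr _).nc h h'
    · simp only [BinaryTree.numNodes, Set.mem_Icc] at hp hq
      by_cases h₁ : q ≤ a + l.numNodes
      · refine Or.inr (Or.inl ((hl a).max ⟨hp.1, by omega⟩ ⟨by omega, h₁⟩ hpq fun p' q' h' => ?_))
        exact h p' q' (Or.inr (Or.inl h'))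
      by_cases h₂ : a + l.numNodes + 1 ≤ p
      · refine Or.inr (Or.inr ((hr _).max ⟨h₂, by omega⟩ ⟨by omega, by omega⟩ hpq
          fun p' q' h' => ?_))
        exact h p' q' (Or.inr (Or.inr h'))
      -- A pair joining the two blocks crosses the root of the left block unless p = a, and the root
      -- of the right block unless q is the last point.
      refine Or.inl ⟨?_, ?_⟩
      · by_contra hpa
        have := (h _ _ (Or.inr (Or.inl (treePairs_root l a (by omega))))).2
        simp only [Crosses] at this
        omega
      · by_contra hqa
        have := (h _ _ (Or.inr (Or.inr (treePairs_root r (a + l.numNodes + 1) (by omega))))).1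
        simp only [Crosses] at this
        omega

/-- The pair of extreme points crosses nothing, so it belongs to X. The second longest pair starting
at a separates the remaining pairs into two blocks, each again maximal. -/
theorem MaxNC.exists_tree (N : ℕ) : ∀ {a : ℕ} {X : ℕ → ℕ → Prop}, MaxNC (Set.Icc a (a + N)) X →
    ∃ t : BinaryTree Unit, t.numNodes = N ∧ X = treePairs t a := by
  induction N using Nat.strong_induction_on with
  | _ N ih =>
    intro a X hX
    rcases Nat.eq_zero_or_pos N with rfl | hN
    · refine ⟨.nil, rfl, ?_⟩
      funext p q
      refine propext ⟨fun h => ?_, fun h => h.elim⟩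
      have := hX.mem h
      simp only [Set.mem_Icc] at this
      omega
    have hb : ∀ {p q}, X p q → a ≤ p ∧ p < q ∧ q ≤ a + N := fun h => by
      have := hX.mem h
      simp only [Set.mem_Icc] at this
      omega
    have hroot : X a (a + N) := by
      refine hX.max (by simp) (by simp) (by omega) fun p' q' h => ?_
      have := hb h
      simp only [Crosses]
      omega
    -- The value m = 0 stands for an empty left subtree.
    obtain ⟨m, hmN, hm, hmax⟩ : ∃ m, m < N ∧ (m = 0 ∨ X a (a + m)) ∧
        ∀ j, j < N → X a (a + j) → j ≤ m := by
      classical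
      let P := fun m => m = 0 ∨ X a (a + m)
      refine ⟨Nat.findGreatest P (N - 1), ?_, Nat.findGreatest_spec (P := P) (Nat.zero_le _)
        (Or.inl rfl), fun j hj h => Nat.le_findGreatest (by omega) (Or.inr h)⟩
      have := Nat.findGreatest_le (P := P) (N - 1)
      omega
    -- A pair joining the blocks contradicts the choice of m if it starts at a, and otherwise
    -- crosses (a, a+m).
    have hsplit : ∀ {p q}, X p q → (p = a ∧ q = a + N) ∨ q ≤ a + m ∨ a + m + 1 ≤ p := by
      intro p q h
      have hpq := hb h
      by_contra! hc
      rcases eq_or_ne p a with rfl | hpa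
      · have := hmax (q - p) (by omega) (by rwa [Nat.add_sub_cancel' hpq.2.1.le])
        omega
      · rcases hm with rfl | hm
        · omega
        · have := hX.nc hm h
          simp only [Crosses] at this
          omega
    have hl : MaxNC (Set.Icc a (a + m)) (fun p q => X p q ∧ q ≤ a + m) := by
      refine ⟨fun {p q} h => ?_, fun h h' => hX.nc h.1 h'.1, fun {p q} hp hq hpq h => ?_⟩
      · have := hb h.1
        simp only [Set.mem_Icc]; omega
      · simp only [Set.mem_Icc] at hp hq
        refine ⟨hX.max ⟨hp.1, by omega⟩ ⟨hq.1, by omega⟩ hpq fun p' q' h' => ?_, hq.2⟩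
        rcases hsplit h' with h₁ | h₁ | h₁
        · simp only [Crosses]; omega
        · exact h p' q' ⟨h', h₁⟩
        · have := hb h'
          simp only [Crosses]; omega
    have hr : MaxNC (Set.Icc (a + m + 1) (a + m + 1 + (N - m - 1)))
        (fun p q => X p q ∧ a + m + 1 ≤ p) := by
      refine ⟨fun {p q} h => ?_, fun h h' => hX.nc h.1 h'.1, fun {p q} hp hq hpq h => ?_⟩
      · have := hb h.1
        have := h.2
        simp only [Set.mem_Icc]; omega
      · simp only [Set.mem_Icc] at hp hq
        refine ⟨hX.max ⟨by omega, by omega⟩ ⟨by omega, by omega⟩ hpq fun p' q' h' => ?_, hp.1⟩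
        rcases hsplit h' with h₁ | h₁ | h₁
        · simp only [Crosses]; omega
        · have := hb h'
          simp only [Crosses]; omega
        · exact h p' q' ⟨h', h₁⟩
    obtain ⟨l, hln, hl⟩ := ih m hmN hl
    obtain ⟨r, hrn, hr⟩ := ih (N - m - 1) (by omega) hr
    have hsum : l.numNodes + r.numNodes + 1 = N := by omega
    refine ⟨.node () l r, hsum, ?_⟩
    funext p q
    rw [treePairs, hsum, hln, ← congrFun (congrFun hl p) q, ← congrFun (congrFun hr p) q]
    refine propext ⟨fun h => ?_, ?_⟩
    · rcases hsplit h with h₁ | h₁ | h₁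
      · exact Or.inl h₁
      · exact Or.inr (Or.inl ⟨h, h₁⟩)
      · exact Or.inr (Or.inr ⟨h, h₁⟩)
    · rintro (⟨rfl, rfl⟩ | h | h)
      · exact hroot
      · exact h.1
      · exact h.1

/-- The longest pair starting at a, apart from the root, reveals the size of the left subtree; the
blocks then separate the two subfamilies. -/
theorem treePairs_injective (t : BinaryTree Unit) : ∀ {t' : BinaryTree Unit} {a : ℕ},
    t.numNodes = t'.numNodes → treePairs t a = treePairs t' a → t = t' := by
  induction t with
  | nil =>
    intro t' a hn _
    cases t' with
    | nil => rfl
    | node => simp at hn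
  | node v l r hl hr =>
    intro t' a hn h
    cases t' with
    | nil => simp at hn
    | node v' l' r' =>
    have hiff : ∀ p q, treePairs (.node v l r) a p q ↔ treePairs (.node v' l' r') a p q := by
      intro p q; rw [h]
    simp only [BinaryTree.numNodes] at hn
    simp only [treePairs] at hiff
    have key : ∀ {l r l' r' : BinaryTree Unit},
        l.numNodes + r.numNodes + 1 = l'.numNodes + r'.numNodes + 1 →
        (∀ p q, (p = a ∧ q = a + (l.numNodes + r.numNodes + 1)) ∨ treePairs l a p q ∨
          treePairs r (a + l.numNodes + 1) p q → (p = a ∧ q = a + (l'.numNodes + r'.numNodes + 1)) ∨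
          treePairs l' a p q ∨ treePairs r' (a + l'.numNodes + 1) p q) →
        l.numNodes ≤ l'.numNodes := by
      intro l r l' r' hn h
      by_contra! hc
      rcases h _ _ (Or.inr (Or.inl (treePairs_root l a (by omega)))) with h | h | h
      · omega
      · have := treePairs_bounds _ h; omega
      · have := treePairs_bounds _ h; omega
    have hll : l.numNodes = l'.numNodes := le_antisymm
      (key hn fun p q h => (hiff p q).1 h) (key hn.symm fun p q h => (hiff p q).2 h)
    have hrr : r.numNodes = r'.numNodes := by omega
    have h₁ : treePairs l a = treePairs l' a := by
      funext p q
      have b := treePairs_bounds l (a := a) (p := p) (q := q)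
      have b' := treePairs_bounds l' (a := a) (p := p) (q := q)
      have c := treePairs_bounds r (a := a + l.numNodes + 1) (p := p) (q := q)
      have c' := treePairs_bounds r' (a := a + l'.numNodes + 1) (p := p) (q := q)
      refine propext ⟨fun h => ?_, fun h => ?_⟩
      · have := b h
        rcases (hiff p q).1 (Or.inr (Or.inl h)) with h' | h' | h'
        · omega
        · exact h'
        · have := c' h'; omega
      · have := b' h
        rcases (hiff p q).2 (Or.inr (Or.inl h)) with h' | h' | h'
        · omega
        · exact h'
        · have := c h'; omega
    have h₂ : treePairs r (a + l.numNodes + 1) = treePairs r' (a + l.numNodes + 1) := by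
      funext p q
      have b := treePairs_bounds l (a := a) (p := p) (q := q)
      have b' := treePairs_bounds l' (a := a) (p := p) (q := q)
      have c := treePairs_bounds r (a := a + l.numNodes + 1) (p := p) (q := q)
      have c' := treePairs_bounds r' (a := a + l.numNodes + 1) (p := p) (q := q)
      rw [← hll] at hiff
      refine propext ⟨fun h => ?_, fun h => ?_⟩
      · have := c h
        rcases (hiff p q).1 (Or.inr (Or.inr h)) with h' | h' | h'
        · omega
        · have := b' h'; omega
        · exact h'
      · have := c' h
        rcases (hiff p q).2 (Or.inr (Or.inr h)) with h' | h' | h'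
        · omega
        · have := b h'; omega
        · exact h'
    rw [hl hll h₁, hr hrr h₂]

theorem setOf_maxNC_Icc (N : ℕ) : {X | MaxNC (Set.Icc 0 N) X} =
    (fun t => treePairs t 0) '' (BinaryTree.treesOfNumNodesEq N : Set (BinaryTree Unit)) := by
  ext X
  simp only [Set.mem_ofPred_eq, Set.mem_image, Finset.mem_coe, BinaryTree.mem_treesOfNumNodesEq]
  constructor
  · intro h
    obtain ⟨t, ht, rfl⟩ := MaxNC.exists_tree N (a := 0) (X := X) (by rwa [Nat.zero_add])
    exact ⟨t, ht, rfl⟩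
  · rintro ⟨t, rfl, rfl⟩
    have := maxNC_treePairs t 0
    rwa [Nat.zero_add] at this

theorem finite_setOf_maxNC_Icc (N : ℕ) : {X | MaxNC (Set.Icc 0 N) X}.Finite := by
  rw [setOf_maxNC_Icc]
  exact (Finset.finite_toSet _).image _

theorem ncard_setOf_maxNC_Icc (N : ℕ) : {X | MaxNC (Set.Icc 0 N) X}.ncard = catalan N := by
  rw [setOf_maxNC_Icc, Set.InjOn.ncard_image, Set.ncard_coe_finset,
    BinaryTree.treesOfNumNodesEq_card_eq_catalan]
  intro t ht t' ht' h
  simp only [Finset.mem_coe, BinaryTree.mem_treesOfNumNodesEq] at ht ht'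
  exact treePairs_injective t (ht.trans ht'.symm) h

/-- Maximal noncrossing families correspond to each other under an order isomorphism onto `E`. -/
theorem bijOn_maxNC_map {C : Type*} [LinearOrder C] {N : ℕ} {e : ℕ → C}
    (he : StrictMonoOn e (Set.Icc 0 N)) :
    Set.BijOn (fun (Y : ℕ → ℕ → Prop) p q => ∃ i j, Y i j ∧ e i = p ∧ e j = q)
      {Y | MaxNC (Set.Icc 0 N) Y} {X | MaxNC (e '' Set.Icc 0 N) X} := by
  have hcr : ∀ {i j i' j'}, i ∈ Set.Icc 0 N → j ∈ Set.Icc 0 N → i' ∈ Set.Icc 0 N →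
      j' ∈ Set.Icc 0 N → (Crosses (e i) (e j) (e i') (e j') ↔ Crosses i j i' j') := by
    intro i j i' j' h₁ h₂ h₃ h₄
    simp only [Crosses, he.lt_iff_lt h₁ h₃, he.le_iff_le h₃ h₂, he.lt_iff_lt h₂ h₄]
  have hmap : ∀ {Y : ℕ → ℕ → Prop}, MaxNC (Set.Icc 0 N) Y → ∀ {i j}, i ∈ Set.Icc 0 N →
      j ∈ Set.Icc 0 N → ((∃ i' j', Y i' j' ∧ e i' = e i ∧ e j' = e j) ↔ Y i j) := by
    intro Y hY i j hi hj
    refine ⟨?_, fun h => ⟨i, j, h, rfl, rfl⟩⟩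
    rintro ⟨i', j', h, h₁, h₂⟩
    rw [← he.injOn (hY.mem h).1 hi h₁, ← he.injOn (hY.mem h).2.1 hj h₂]
    exact h
  refine ⟨fun Y hY => ?_, fun Y hY Y' hY' h => ?_, fun X hX => ?_⟩
  · refine ⟨?_, ?_, ?_⟩
    · rintro _ _ ⟨i, j, h, rfl, rfl⟩
      have := hY.mem h
      exact ⟨⟨i, this.1, rfl⟩, ⟨j, this.2.1, rfl⟩, (he.lt_iff_lt this.1 this.2.1).2 this.2.2⟩
    · rintro _ _ _ _ ⟨i, j, h, rfl, rfl⟩ ⟨i', j', h', rfl, rfl⟩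
      rw [hcr (hY.mem h).1 (hY.mem h).2.1 (hY.mem h').1 (hY.mem h').2.1]
      exact hY.nc h h'
    · rintro _ _ ⟨i, hi, rfl⟩ ⟨j, hj, rfl⟩ hij h
      refine ⟨i, j, hY.max hi hj ((he.lt_iff_lt hi hj).1 hij) fun i' j' h' => ?_, rfl, rfl⟩
      have := h _ _ ⟨i', j', h', rfl, rfl⟩
      rwa [hcr hi hj (hY.mem h').1 (hY.mem h').2.1, hcr (hY.mem h').1 (hY.mem h').2.1 hi hj]
        at this
  · funext i j
    refine propext ⟨fun hij => ?_, fun hij => ?_⟩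
    · have hm := hY.mem hij
      rw [← hmap hY' hm.1 hm.2.1]
      have := congrFun (congrFun h (e i)) (e j)
      exact this.mp ⟨i, j, hij, rfl, rfl⟩
    · have hm := hY'.mem hij
      rw [← hmap hY hm.1 hm.2.1]
      have := congrFun (congrFun h (e i)) (e j)
      exact this.mpr ⟨i, j, hij, rfl, rfl⟩
  · refine ⟨fun i j => i ∈ Set.Icc 0 N ∧ j ∈ Set.Icc 0 N ∧ X (e i) (e j), ?_, ?_⟩
    · refine ⟨fun h => ⟨h.1, h.2.1, (he.lt_iff_lt h.1 h.2.1).1 (hX.mem h.2.2).2.2⟩,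
        fun h h' => ?_, fun {i j} hi hj hij h => ⟨hi, hj, ?_⟩⟩
      · rw [← hcr h.1 h.2.1 h'.1 h'.2.1]
        exact hX.nc h.2.2 h'.2.2
      · refine hX.max ⟨i, hi, rfl⟩ ⟨j, hj, rfl⟩ ((he.lt_iff_lt hi hj).2 hij) fun p' q' h' => ?_
        obtain ⟨⟨i', hi', rfl⟩, ⟨j', hj', rfl⟩, -⟩ := hX.mem h'
        rw [hcr hi hj hi' hj', hcr hi' hj' hi hj]
        exact h i' j' ⟨hi', hj', h'⟩
    · funext p q
      refine propext ⟨?_, fun h => ?_⟩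
      · rintro ⟨i, j, h, rfl, rfl⟩
        exact h.2.2
      · obtain ⟨⟨i, hi, rfl⟩, ⟨j, hj, rfl⟩, -⟩ := hX.mem h
        exact ⟨i, j, ⟨hi, hj, h⟩, rfl, rfl⟩

theorem finite_setOf_maxNC_image {C : Type*} [LinearOrder C] {N : ℕ} {e : ℕ → C}
    (he : StrictMonoOn e (Set.Icc 0 N)) : {X | MaxNC (e '' Set.Icc 0 N) X}.Finite := by
  rw [← (bijOn_maxNC_map he).image_eq]
  exact (finite_setOf_maxNC_Icc N).image _

theorem ncard_setOf_maxNC_image {C : Type*} [LinearOrder C] {N : ℕ} {e : ℕ → C}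
    (he : StrictMonoOn e (Set.Icc 0 N)) :
    {X | MaxNC (e '' Set.Icc 0 N) X}.ncard = catalan N := by
  rw [← (bijOn_maxNC_map he).image_eq, (bijOn_maxNC_map he).injOn.ncard_image,
    ncard_setOf_maxNC_Icc]

/-! ### Noncrossing families and gaps -/

section Gaps

variable {C ι : Type*} [LinearOrder C]

/-- A linear order that consists of a finite set `E`, containing the endpoints, and of disjoint
open intervals `(l s, r s)` between elements of `E`, without immediate neighbours of their ends. -/
structure GapSystem (E : Set C) (l r : ι → C) : Prop where
  l_mem : ∀ s, l s ∈ E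
  r_mem : ∀ s, r s ∈ E
  lt : ∀ s, l s < r s
  cover : ∀ c, c ∈ E ∨ ∃ s, l s < c ∧ c < r s
  avoid : ∀ c ∈ E, ∀ s, c ≤ l s ∨ r s ≤ c
  disj : ∀ s s' c, l s < c → c < r s → l s' < c → c < r s' → s = s'
  below : ∀ s c, l s < c → ∃ g, l s < g ∧ g < c
  above : ∀ s c, c < r s → ∃ g, c < g ∧ g < r s
  fin : E.Finite
  bot : ∃ m ∈ E, ∀ c, m ≤ c
  top : ∃ m ∈ E, ∀ c, c ≤ m

/-- The pairs of `X` with one entry in the gap `s` and the other one outside are the pairs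
`(g, b)`, for a fixed `b` to the right of the gap. -/
def RightFan (E : Set C) (l r : ι → C) (X : C → C → Prop) (s : ι) (b : C) : Prop :=
  b ∈ E ∧ r s ≤ b ∧ ∀ g, l s < g ∧ g < r s →
    (∀ q, r s ≤ q → (X g q ↔ q = b)) ∧ ∀ p, p ≤ l s → ¬ X p g

/-- The pairs of `X` with one entry in the gap `s` and the other one outside are the pairs
`(a, g)`, for a fixed `a` to the left of the gap. -/
def LeftFan (E : Set C) (l r : ι → C) (X : C → C → Prop) (s : ι) (a : C) : Prop :=
  a ∈ E ∧ a ≤ l s ∧ ∀ g, l s < g ∧ g < r s →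
    (∀ p, p ≤ l s → (X p g ↔ p = a)) ∧ ∀ q, r s ≤ q → ¬ X g q

/-- `X` has a fan at each gap. -/
def HasFans (E : Set C) (l r : ι → C) (X : C → C → Prop) : Prop :=
  ∀ s, (∃ b, RightFan E l r X s b) ∨ ∃ a, LeftFan E l r X s a

variable {E : Set C} {l r : ι → C} {X : C → C → Prop}

/-- Reversing the order preserves crossing but exchanges the two pairs. Hence every statement about
right fans has a mirror image for left fans. -/
theorem MaxNC.dual (h : MaxNC E X) : MaxNC (C := Cᵒᵈ) E (fun p q => X q p) where
  mem h' := ⟨(h.mem h').2.1, (h.mem h').1, (h.mem h').2.2⟩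
  nc h₁ h₂ hc := h.nc h₂ h₁ ⟨hc.2.2, hc.2.1, hc.1⟩
  max hp hq hpq h' := h.max hq hp hpq fun p' q' hX =>
    ⟨fun hc => (h' q' p' hX).2 ⟨hc.2.2, hc.2.1, hc.1⟩,
      fun hc => (h' q' p' hX).1 ⟨hc.2.2, hc.2.1, hc.1⟩⟩

theorem GapSystem.dual (h : GapSystem E l r) : GapSystem (C := Cᵒᵈ) E r l where
  l_mem := h.r_mem
  r_mem := h.l_mem
  lt := h.lt
  cover c := (h.cover c).imp_right fun ⟨s, hs⟩ => ⟨s, hs.2, hs.1⟩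
  avoid c hc s := (h.avoid c hc s).symm
  disj s s' c h₁ h₂ h₃ h₄ := h.disj s s' c h₂ h₁ h₄ h₃
  below s c hc := (h.above s c hc).imp fun _ hg => ⟨hg.2, hg.1⟩
  above s c hc := (h.below s c hc).imp fun _ hg => ⟨hg.2, hg.1⟩
  fin := h.fin
  bot := h.top
  top := h.bot

theorem rightFan_dual {s : ι} {a : C} :
    RightFan (C := Cᵒᵈ) E r l (fun p q => X q p) s a ↔ LeftFan (C := C) E l r X s a :=
  ⟨fun h => ⟨h.1, h.2.1, fun g hg => h.2.2 g hg.symm⟩,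
    fun h => ⟨h.1, h.2.1, fun g hg => h.2.2 g hg.symm⟩⟩

theorem leftFan_dual {s : ι} {b : C} :
    LeftFan (C := Cᵒᵈ) E r l (fun p q => X q p) s b ↔ RightFan (C := C) E l r X s b :=
  ⟨fun h => ⟨h.1, h.2.1, fun g hg => h.2.2 g hg.symm⟩,
    fun h => ⟨h.1, h.2.1, fun g hg => h.2.2 g hg.symm⟩⟩

theorem HasFans.dual (h : HasFans E l r X) :
    HasFans (C := Cᵒᵈ) E r l (fun p q => X q p) := fun s =>
  (h s).symm.imp (fun ⟨a, ha⟩ => ⟨a, rightFan_dual.2 ha⟩) fun ⟨b, hb⟩ => ⟨b, leftFan_dual.2 hb⟩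

/-! ### Restriction of a family with fans to the grid -/

section Restrict

variable (hG : GapSystem E l r) (hX : MaxNC Set.univ X) (hF : HasFans E l r X)

include hG hX

/-- Together with `RightFan.rel_end`, this identifies the apex of a right fan by grid pairs only: it
is the largest right partner of `r s`, or `r s` itself. -/
theorem RightFan.le_of_rel {s : ι} {b j : C} (h : RightFan E l r X s b) (hj : X (r s) j) :
    j ≤ b := by
  obtain ⟨g, hg⟩ := hG.below s (r s) (hG.lt s)
  by_contra! hc
  exact hX.nc (((h.2.2 g hg).1 b h.2.1).2 rfl) hj ⟨hg.2, h.2.1, hc⟩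

/-- A pair crossing (r s, b) would cross some (g, b) with g in the gap, or start in the gap and end
at a cut other than b. -/
theorem RightFan.rel_end {s : ι} {b : C} (h : RightFan E l r X s b) (hb : r s < b) :
    X (r s) b := by
  obtain ⟨g, hg⟩ := hG.below s (r s) (hG.lt s)
  have hgb : ∀ g, l s < g ∧ g < r s → X g b := fun g hg => ((h.2.2 g hg).1 b h.2.1).2 rfl
  refine hX.max trivial trivial hb fun p q hpq => ⟨fun hc => ?_, fun hc => ?_⟩
  · exact hX.nc (hgb g hg) hpq ⟨hg.2.trans hc.1, hc.2.1, hc.2.2⟩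
  · rcases le_or_gt p (l s) with hp | hp
    · exact hX.nc hpq (hgb g hg) ⟨hp.trans_lt hg.1, hg.2.le.trans hc.2.1, hc.2.2⟩
    · exact hc.2.2.ne (((h.2.2 p ⟨hp, hc.1⟩).1 q hc.2.1).1 hpq)

include hF

-- A pair starting in a gap crosses a left fan there at its starting cut, and crosses a right fan if
-- it ends inside the gap. So no pair lies within a gap.
omit hG in
theorem rightFan_of_rel {s : ι} {p q : C} (hpq : X p q) (hp : l s < p ∧ p < r s) :
    RightFan E l r X s q := by
  rcases hF s with ⟨b, h⟩ | ⟨a, h⟩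
  · rcases le_or_gt (r s) q with hq | hq
    · obtain rfl := ((h.2.2 p hp).1 q hq).1 hpq
      exact h
    · have hlt := (hX.mem hpq).2.2
      exact absurd ⟨hlt, le_rfl, hq.trans_le h.2.1⟩
        (hX.nc hpq (((h.2.2 q ⟨hp.1.trans hlt, hq⟩).1 b h.2.1).2 rfl))
  · exact absurd ⟨h.2.1.trans_lt hp.1, le_rfl, (hX.mem hpq).2.2⟩
      (hX.nc (((h.2.2 p hp).1 a h.2.1).2 rfl) hpq)

omit hG in
theorem leftFan_of_rel {s : ι} {p q : C} (hpq : X p q) (hq : l s < q ∧ q < r s) :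
    LeftFan E l r X s p :=
  rightFan_dual.1 (rightFan_of_rel (C := Cᵒᵈ) hX.dual hF.dual hpq hq.symm)

/-- A grid pair closes the fan from the left. It comes from a tightest grid pair (i, j) with i ≤ `l
s` and b ≤ j: if b < j, then (i, b) crosses nothing, which contradicts tightness. -/
theorem RightFan.exists_rel {s : ι} {b : C} (h : RightFan E l r X s b) :
    ∃ a ∈ E, a ≤ l s ∧ X a b := by
  obtain ⟨m, hm, hm'⟩ := hG.bot
  obtain ⟨M, hM, hM'⟩ := hG.top
  have hmM : X m M := by
    refine hX.max trivial trivial (((hm' _).trans_lt (hG.lt s)).trans_le (hM' _))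
      fun p q _ => ⟨fun hc => ?_, fun hc => ?_⟩
    · exact not_lt.2 (hM' _) hc.2.2
    · exact not_lt.2 (hm' _) hc.1
  obtain ⟨j, ⟨hjE, hbj, hj⟩, hjmin⟩ := Set.exists_min_image
    {j | j ∈ E ∧ b ≤ j ∧ ∃ i ∈ E, i ≤ l s ∧ X i j} id (hG.fin.subset fun _ h => h.1)
    ⟨M, hM, hM' _, m, hm, hm' _, hmM⟩
  obtain ⟨i, ⟨hiE, his, hij⟩, himax⟩ := Set.exists_max_image
    {i | i ∈ E ∧ i ≤ l s ∧ X i j} id (hG.fin.subset fun _ h => h.1) hj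
  simp only [id] at hjmin himax
  obtain rfl | hlt := hbj.eq_or_lt
  · exact ⟨i, hiE, his, hij⟩
  refine ⟨i, hiE, his, ?_⟩
  obtain ⟨g, hg⟩ := hG.below s (r s) (hG.lt s)
  have hgb : X g b := ((h.2.2 g hg).1 b h.2.1).2 rfl
  have key : ∀ p ∈ E, ∀ q ∈ E, p ≤ l s → X p q → i < p → b ≤ q → q ≤ j → False := by
    intro p hp q hq hps hpq hip hbq hqj
    obtain rfl : q = j := le_antisymm hqj (hjmin q ⟨hq, hbq, p, hp, hps, hpq⟩)
    exact not_lt.2 (himax p ⟨hp, hps, hpq⟩) hip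
  refine hX.max trivial trivial (his.trans_lt ((hG.lt s).trans_le h.2.1)) fun p q hpq =>
    ⟨fun hc => ?_, fun hc => hX.nc hpq hij ⟨hc.1, hc.2.1, hc.2.2.trans hlt⟩⟩
  obtain ⟨h₁, h₂, h₃⟩ := hc
  have hqj : q ≤ j := by
    by_contra! hh
    exact hX.nc hij hpq ⟨h₁, h₂.trans hlt.le, hh⟩
  have hps : p ≤ l s := by
    by_contra! hh
    rcases lt_or_ge p (r s) with hp | hp
    · exact h₃.ne' (((h.2.2 p ⟨hh, hp⟩).1 q (h.2.1.trans h₃.le)).1 hpq)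
    · exact hX.nc hgb hpq ⟨hg.2.trans_le hp, h₂, h₃⟩
  -- An entry inside a gap t is moved to the grid: its fan also contains the end of t facing the
  -- other entry.
  obtain ⟨p', hp'E, hps', hpp', hpq'⟩ : ∃ p' ∈ E, p' ≤ l s ∧ p ≤ p' ∧ X p' q := by
    rcases hG.cover p with hp | ⟨t, ht⟩
    · exact ⟨p, hp, hps, le_rfl, hpq⟩
    · have ht' := rightFan_of_rel hX hF hpq ht
      have hts : r t ≤ l s := (hG.avoid _ (hG.l_mem s) t).resolve_left
        (not_le.2 (ht.1.trans_le hps))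
      refine ⟨r t, hG.r_mem t, hts, ht.2.le, ht'.rel_end hG hX ?_⟩
      exact hts.trans_lt ((hG.lt s).trans_le (h.2.1.trans h₃.le))
  rcases hG.cover q with hq | ⟨t, ht⟩
  · exact key p' hp'E q hq hps' hpq' (h₁.trans_le hpp') h₃.le hqj
  · have ht' := leftFan_of_rel hX hF hpq' ht
    have hbt : b ≤ l t := (hG.avoid b h.1 t).resolve_right (not_le.2 (h₃.trans ht.2))
    refine key p' hp'E (l t) (hG.l_mem t) hps' ?_ (h₁.trans_le hpp') hbt (ht.1.le.trans hqj)
    refine RightFan.rel_end (C := Cᵒᵈ) hG.dual hX.dual (rightFan_dual.2 ht') ?_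
    exact (hps'.trans_lt ((hG.lt s).trans_le h.2.1)).trans_le hbt

/-- If (i, j) crossed a pair (p, q) starting in a gap, it would also cross a grid pair ending at q:
(r s, q), or the pair that closes the fan from the left. -/
theorem not_crosses_of_gap {i j p q : C} (hj : j ∈ E)
    (hij : ∀ p' q', p' ∈ E ∧ q' ∈ E ∧ X p' q' → ¬ Crosses i j p' q' ∧ ¬ Crosses p' q' i j)
    {s : ι} (hp : l s < p ∧ p < r s) (hpq : X p q) : ¬ Crosses i j p q ∧ ¬ Crosses p q i j := by
  have h := rightFan_of_rel hX hF hpq hp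
  refine ⟨fun hc => ?_, fun hc => ?_⟩
  · have hrj : r s ≤ j := (hG.avoid j hj s).resolve_left (not_le.2 (hp.1.trans_le hc.2.1))
    exact (hij _ _ ⟨hG.r_mem s, h.1, h.rel_end hG hX (hrj.trans_lt hc.2.2)⟩).1
      ⟨hc.1.trans hp.2, hrj, hc.2.2⟩
  · obtain ⟨a, ha, has, hab⟩ := h.exists_rel hG hX hF
    exact (hij _ _ ⟨ha, h.1, hab⟩).2 ⟨has.trans_lt (hp.1.trans hc.1), hc.2.1, hc.2.2⟩

theorem maxNC_restrict : MaxNC E (fun p q => p ∈ E ∧ q ∈ E ∧ X p q) where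
  mem h := ⟨h.1, h.2.1, (hX.mem h.2.2).2.2⟩
  nc h h' := hX.nc h.2.2 h'.2.2
  max {i j} hi hj hij h := by
    refine ⟨hi, hj, hX.max trivial trivial hij fun p q hpq => ?_⟩
    rcases hG.cover p with hp | ⟨s, hs⟩
    · rcases hG.cover q with hq | ⟨s, hs⟩
      · exact h p q ⟨hp, hq, hpq⟩
      · have := not_crosses_of_gap (C := Cᵒᵈ) hG.dual hX.dual hF.dual hi (fun p' q' h' => by
          have := h q' p' ⟨h'.2.1, h'.1, h'.2.2⟩
          exact ⟨fun hc => this.2 ⟨hc.2.2, hc.2.1, hc.1⟩,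
            fun hc => this.1 ⟨hc.2.2, hc.2.1, hc.1⟩⟩) hs.symm hpq
        exact ⟨fun hc => this.2 ⟨hc.2.2, hc.2.1, hc.1⟩, fun hc => this.1 ⟨hc.2.2, hc.2.1, hc.1⟩⟩
    · exact not_crosses_of_gap hG hX hF hj h hs hpq

omit hX hF in
theorem not_rightFan_and_leftFan {s : ι} {a b : C} (h : RightFan E l r X s b)
    (h' : LeftFan E l r X s a) : False := by
  obtain ⟨g, hg⟩ := hG.below s (r s) (hG.lt s)
  exact (h'.2.2 g hg).2 b h.2.1 (((h.2.2 g hg).1 b h.2.1).2 rfl)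

-- Unless b = `r s`, the grid pair (r s, b) also lies in X', and the apex of X' bounds all right
-- partners of `r s`.
omit hF in
theorem RightFan.apex_le {X' : C → C → Prop} (hX' : MaxNC Set.univ X')
    (he : ∀ p ∈ E, ∀ q ∈ E, X p q → X' p q) {s : ι} {b b' : C} (h : RightFan E l r X s b)
    (h' : RightFan E l r X' s b') : b ≤ b' := by
  rcases h.2.1.eq_or_lt with hb | hb
  · exact hb ▸ h'.2.1
  · exact h'.le_of_rel hG hX' (he _ (hG.r_mem s) _ h.1 (h.rel_end hG hX hb))

theorem rel_of_rel_of_gap {X' : C → C → Prop} (hX' : MaxNC Set.univ X')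
    (he : ∀ p ∈ E, ∀ q ∈ E, X p q ↔ X' p q)
    (hr : ∀ s b, RightFan E l r X s b → ∃ b', RightFan E l r X' s b')
    {s : ι} {p q : C} (hp : l s < p ∧ p < r s) (hpq : X p q) : X' p q := by
  have h := rightFan_of_rel hX hF hpq hp
  obtain ⟨b', h'⟩ := hr s q h
  have h₁ := h.apex_le hG hX hX' (fun p hp q hq => (he p hp q hq).1) h'
  have h₂ := h'.apex_le hG hX' hX (fun p hp q hq => (he p hp q hq).2) h
  exact ((h'.2.2 p hp).1 q h.2.1).2 (le_antisymm h₁ h₂)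

theorem rel_of_restrict_eq {X' : C → C → Prop} (hX' : MaxNC Set.univ X') (hF' : HasFans E l r X')
    (he : ∀ p ∈ E, ∀ q ∈ E, X p q ↔ X' p q)
    (hr : ∀ s, (∃ b, RightFan E l r X s b) ↔ ∃ b', RightFan E l r X' s b')
    {p q : C} (hpq : X p q) : X' p q := by
  rcases hG.cover p with hp | ⟨s, hs⟩
  · rcases hG.cover q with hq | ⟨s, hs⟩
    · exact (he p hp q hq).1 hpq
    · refine rel_of_rel_of_gap (C := Cᵒᵈ) hG.dual hX.dual hF.dual hX'.dual
        (fun p hp q hq => he q hq p hp) (fun t b hb => ?_) hs.symm hpq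
      rcases hF' t with h | ⟨a, ha⟩
      · obtain ⟨b', hb'⟩ := (hr t).2 h
        exact (not_rightFan_and_leftFan hG hb' (rightFan_dual.1 hb)).elim
      · exact ⟨a, rightFan_dual.2 ha⟩
  · exact rel_of_rel_of_gap hG hX hF hX' he (fun t b hb => (hr t).1 ⟨b, hb⟩) hs hpq

end Restrict

end Gaps

/-! ### Extension of a family on the grid by fans -/

section Extend

variable {C ι : Type*} [LinearOrder C] {E : Set C} {l r : ι → C} {Y : C → C → Prop}

/-- `b` is the largest right partner of `r s`, or `r s` itself if there is none. -/
structure IsRightApex (E : Set C) (r : ι → C) (Y : C → C → Prop) (s : ι) (b : C) : Prop where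
  mem : b ∈ E
  le : r s ≤ b
  rel : r s < b → Y (r s) b
  max : ∀ {j}, Y (r s) j → j ≤ b

/-- `a` is the smallest left partner of `l s`, or `l s` itself if there is none. -/
structure IsLeftApex (E : Set C) (l : ι → C) (Y : C → C → Prop) (s : ι) (a : C) : Prop where
  mem : a ∈ E
  le : a ≤ l s
  rel : a < l s → Y a (l s)
  min : ∀ {i}, Y i (l s) → a ≤ i

theorem IsRightApex.dual {s : ι} {b : C} (h : IsRightApex E r Y s b) :
    IsLeftApex (C := Cᵒᵈ) E r (fun p q => Y q p) s b :=
  ⟨h.mem, h.le, h.rel, h.max⟩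

theorem IsLeftApex.dual {s : ι} {a : C} (h : IsLeftApex E l Y s a) :
    IsRightApex (C := Cᵒᵈ) E l (fun p q => Y q p) s a :=
  ⟨h.mem, h.le, h.rel, h.min⟩

theorem exists_isRightApex (hG : GapSystem E l r) (hY : MaxNC E Y) (s : ι) :
    ∃ b, IsRightApex E r Y s b := by
  obtain ⟨b, hb, hmax⟩ := Set.exists_max_image {j | j ∈ E ∧ (j = r s ∨ Y (r s) j)} id
    (hG.fin.subset fun _ h => h.1) ⟨r s, hG.r_mem s, Or.inl rfl⟩
  exact ⟨b, hb.1, hmax _ ⟨hG.r_mem s, Or.inl rfl⟩, fun h => hb.2.resolve_left h.ne',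
    fun h => hmax _ ⟨(hY.mem h).2.1, Or.inr h⟩⟩

theorem exists_isLeftApex (hG : GapSystem E l r) (hY : MaxNC E Y) (s : ι) :
    ∃ a, IsLeftApex E l Y s a :=
  (exists_isRightApex (C := Cᵒᵈ) hG.dual hY.dual s).imp fun _ h => ⟨h.mem, h.le, h.rel, h.max⟩

theorem IsRightApex.not_crosses (hG : GapSystem E l r) (hY : MaxNC E Y) {s : ι} {b g i j : C}
    (h : IsRightApex E r Y s b) (hg : l s < g ∧ g < r s) (hij : Y i j) :
    ¬ Crosses i j g b ∧ ¬ Crosses g b i j := by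
  have hm := hY.mem hij
  refine ⟨fun hc => ?_, fun hc => ?_⟩
  · have hrj : r s ≤ j := (hG.avoid j hm.2.1 s).resolve_left (not_le.2 (hg.1.trans_le hc.2.1))
    exact hY.nc hij (h.rel (hrj.trans_lt hc.2.2)) ⟨hc.1.trans hg.2, hrj, hc.2.2⟩
  · have hri : r s ≤ i := (hG.avoid i hm.1 s).resolve_left (not_le.2 (hg.1.trans hc.1))
    rcases hri.eq_or_lt with rfl | hri
    · exact not_lt.2 (h.max hij) hc.2.2
    · exact hY.nc (h.rel (hri.trans_le hc.2.1)) hij ⟨hri, hc.2.1, hc.2.2⟩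

theorem IsLeftApex.not_crosses (hG : GapSystem E l r) (hY : MaxNC E Y) {s : ι} {a g i j : C}
    (h : IsLeftApex E l Y s a) (hg : l s < g ∧ g < r s) (hij : Y i j) :
    ¬ Crosses i j a g ∧ ¬ Crosses a g i j := by
  have := IsRightApex.not_crosses (C := Cᵒᵈ) hG.dual hY.dual h.dual hg.symm hij
  exact ⟨fun hc => this.2 ⟨hc.2.2, hc.2.1, hc.1⟩, fun hc => this.1 ⟨hc.2.2, hc.2.1, hc.1⟩⟩

theorem not_crosses_apex (hG : GapSystem E l r) (hY : MaxNC E Y) {s : ι} {a b i j : C}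
    (ha : IsLeftApex E l Y s a) (hb : IsRightApex E r Y s b) (hij : Y i j) :
    ¬ Crosses i j a b := by
  rintro ⟨h₁, h₂, h₃⟩
  rcases hG.avoid j (hY.mem hij).2.1 s with hj | hj
  · rcases hj.eq_or_lt with rfl | hj
    · exact not_lt.2 (ha.min hij) h₁
    · exact hY.nc hij (ha.rel (h₂.trans_lt hj)) ⟨h₁, h₂, hj⟩
  · exact hY.nc hij (hb.rel (hj.trans_lt h₃)) ⟨h₁.trans_le (ha.le.trans (hG.lt s).le), hj, h₃⟩

/-- The two possible apexes of a gap are always joined. This pair keeps a right fan at one gap from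
crossing a left fan at another. -/
theorem rel_apex (hG : GapSystem E l r) (hY : MaxNC E Y) {s : ι} {a b : C}
    (ha : IsLeftApex E l Y s a) (hb : IsRightApex E r Y s b) : Y a b := by
  refine hY.max ha.mem hb.mem (ha.le.trans_lt ((hG.lt s).trans_le hb.le)) fun i j hij =>
    ⟨fun hc => ?_, not_crosses_apex hG hY ha hb hij⟩
  exact not_crosses_apex (C := Cᵒᵈ) hG.dual hY.dual hb.dual ha.dual hij
    ⟨hc.2.2, hc.2.1, hc.1⟩

/-- The family `Y`, with a fan added at each gap: a right fan at the gaps in `ε` and a left fan at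
the others. -/
def addFans (l r : ι → C) (Y : C → C → Prop) (ε : Set ι) (a b : ι → C) (p q : C) : Prop :=
  Y p q ∨ (∃ s ∈ ε, (l s < p ∧ p < r s) ∧ q = b s) ∨ ∃ s ∉ ε, (l s < q ∧ q < r s) ∧ p = a s

section AddFans

variable {ε : Set ι} {a b : ι → C} (hG : GapSystem E l r) (hY : MaxNC E Y)
  (ha : ∀ s, IsLeftApex E l Y s (a s)) (hb : ∀ s, IsRightApex E r Y s (b s))

include hG

theorem GapSystem.notMem {s : ι} {c : C} (h : l s < c ∧ c < r s) : c ∉ E := fun hc =>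
  (hG.avoid c hc s).elim (not_le.2 h.1) (not_le.2 h.2)

include hY ha hb

/-- When two fan pairs cross, one of them can be replaced by a grid pair attached to its gap, and
apex pairs do not cross grid pairs. -/
theorem addFans_nc {p q p' q' : C} (h : addFans l r Y ε a b p q) (h' : addFans l r Y ε a b p' q') :
    ¬ Crosses p q p' q' := by
  rcases h with h | ⟨s, hs, hg, rfl⟩ | ⟨s, hs, hg, rfl⟩ <;>
    rcases h' with h' | ⟨t, ht, hg', rfl⟩ | ⟨t, ht, hg', rfl⟩
  · exact hY.nc h h'
  · exact ((hb t).not_crosses hG hY hg' h).1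
  · exact ((ha t).not_crosses hG hY hg' h).1
  · exact ((hb s).not_crosses hG hY hg h').2
  · rintro ⟨h₁, h₂, h₃⟩
    have ht : r t ≤ b s := (hG.avoid _ (hb s).mem t).resolve_left (not_le.2 (hg'.1.trans_le h₂))
    exact ((hb s).not_crosses hG hY hg ((hb t).rel (ht.trans_lt h₃))).2
      ⟨h₁.trans hg'.2, ht, h₃⟩
  · rintro ⟨h₁, h₂, h₃⟩
    exact ((hb s).not_crosses hG hY hg (rel_apex hG hY (ha t) (hb t))).2
      ⟨h₁, h₂, h₃.trans (hg'.2.trans_le (hb t).le)⟩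
  · exact ((ha s).not_crosses hG hY hg h').2
  · rintro ⟨h₁, h₂, h₃⟩
    have hst : s ≠ t := fun e => hs (e ▸ ht)
    have htq : r t ≤ q := by
      by_contra! hc
      exact hst (hG.disj s t q hg.1 hg.2 (hg'.1.trans_le h₂) hc)
    exact ((ha s).not_crosses hG hY hg ((hb t).rel (htq.trans_lt h₃))).2
      ⟨h₁.trans hg'.2, htq, h₃⟩
  · rintro ⟨h₁, h₂, h₃⟩
    have hs' : a t ≤ l s := (hG.avoid _ (ha t).mem s).resolve_right (not_le.2 (h₂.trans_lt hg.2))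
    exact ((ha t).not_crosses hG hY hg' ((ha s).rel (h₁.trans_le hs'))).1
      ⟨h₁, hs', hg.1.trans h₃⟩

/-- A pair with an entry g in a gap must be in the fan: if its other end misses the apex, it crosses
a fan pair at a nearby cut or at one of its own ends. This uses that cuts of the gap approach both
ends. -/
theorem maxNC_addFans : MaxNC Set.univ (addFans l r Y ε a b) where
  mem {p q} h := by
    refine ⟨trivial, trivial, ?_⟩
    rcases h with h | ⟨s, hs, hg, rfl⟩ | ⟨s, hs, hg, rfl⟩
    · exact (hY.mem h).2.2
    · exact hg.2.trans_le (hb s).le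
    · exact (ha s).le.trans_lt hg.1
  nc h h' := addFans_nc hG hY ha hb h h'
  max {p q} _ _ hpq h := by
    rcases hG.cover p with hp | ⟨s, hs⟩
    · rcases hG.cover q with hq | ⟨s, hs⟩
      · exact Or.inl (hY.max hp hq hpq fun p' q' h' => h p' q' (Or.inl h'))
      · by_cases hε : s ∈ ε
        · exact absurd ⟨hpq, le_rfl, hs.2.trans_le (hb s).le⟩
            (h q (b s) (Or.inr (Or.inl ⟨s, hε, hs, rfl⟩))).1
        · refine Or.inr (Or.inr ⟨s, hε, hs, ?_⟩)
          have hfan : ∀ g, l s < g ∧ g < r s → _ := fun g hg =>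
            h (a s) g (Or.inr (Or.inr ⟨s, hε, hg, rfl⟩))
          rcases lt_trichotomy p (a s) with hpa | hpa | hpa
          · obtain ⟨g, hg⟩ := hG.above s q hs.2
            exact absurd ⟨hpa, (ha s).le.trans hs.1.le, hg.1⟩
              (hfan g ⟨hs.1.trans hg.1, hg.2⟩).1
          · exact hpa
          · have hp' : p ≤ l s := (hG.avoid p hp s).resolve_right (not_le.2 (hpq.trans hs.2))
            obtain ⟨g, hg⟩ := hG.below s q hs.1
            exact absurd ⟨hpa, hp'.trans hg.1.le, hg.2⟩ (hfan g ⟨hg.1, hg.2.trans hs.2⟩).2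
    · by_cases hε : s ∈ ε
      · refine Or.inr (Or.inl ⟨s, hε, hs, ?_⟩)
        have hfan : ∀ g, l s < g ∧ g < r s → _ := fun g hg =>
          h g (b s) (Or.inr (Or.inl ⟨s, hε, hg, rfl⟩))
        rcases lt_trichotomy q (b s) with hqb | hqb | hqb
        · rcases lt_or_ge q (r s) with hq | hq
          · exact absurd ⟨hpq, le_rfl, hqb⟩ (hfan q ⟨hs.1.trans hpq, hq⟩).1
          · obtain ⟨g, hg⟩ := hG.above s p hs.2
            exact absurd ⟨hg.1, hg.2.le.trans hq, hqb⟩ (hfan g ⟨hs.1.trans hg.1, hg.2⟩).1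
        · exact hqb
        · obtain ⟨g, hg⟩ := hG.below s p hs.1
          exact absurd ⟨hg.2, hs.2.le.trans (hb s).le, hqb⟩ (hfan g ⟨hg.1, hg.2.trans hs.2⟩).2
      · exact absurd ⟨(ha s).le.trans_lt hs.1, le_rfl, hpq⟩
          (h (a s) p (Or.inr (Or.inr ⟨s, hε, hs, rfl⟩))).2

omit hb in
theorem addFans_left_iff {s : ι} {g q : C} (hg : l s < g ∧ g < r s) :
    addFans l r Y ε a b g q ↔ s ∈ ε ∧ q = b s := by
  refine ⟨?_, fun h => Or.inr (Or.inl ⟨s, h.1, hg, h.2⟩)⟩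
  rintro (h | ⟨t, ht, hg', rfl⟩ | ⟨t, ht, hg', rfl⟩)
  · exact absurd (hY.mem h).1 (hG.notMem hg)
  · obtain rfl := hG.disj s t g hg.1 hg.2 hg'.1 hg'.2
    exact ⟨ht, rfl⟩
  · exact absurd (ha t).mem (hG.notMem hg)

omit ha in
theorem addFans_right_iff {s : ι} {p g : C} (hg : l s < g ∧ g < r s) :
    addFans l r Y ε a b p g ↔ s ∉ ε ∧ p = a s := by
  refine ⟨?_, fun h => Or.inr (Or.inr ⟨s, h.1, hg, h.2⟩)⟩
  rintro (h | ⟨t, ht, hg', rfl⟩ | ⟨t, ht, hg', rfl⟩)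
  · exact absurd (hY.mem h).2.1 (hG.notMem hg)
  · exact absurd (hb t).mem (hG.notMem hg)
  · obtain rfl := hG.disj s t g hg.1 hg.2 hg'.1 hg'.2
    exact ⟨ht, rfl⟩

theorem rightFan_addFans {s : ι} (hs : s ∈ ε) : RightFan E l r (addFans l r Y ε a b) s (b s) := by
  refine ⟨(hb s).mem, (hb s).le, fun g hg => ⟨fun q _ => ?_, fun p _ => ?_⟩⟩
  · rw [addFans_left_iff hG hY ha hg, and_iff_right hs]
  · rw [addFans_right_iff hG hY hb hg]
    exact fun h => h.1 hs

theorem leftFan_addFans {s : ι} (hs : s ∉ ε) : LeftFan E l r (addFans l r Y ε a b) s (a s) := by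
  refine ⟨(ha s).mem, (ha s).le, fun g hg => ⟨fun p _ => ?_, fun q _ => ?_⟩⟩
  · rw [addFans_right_iff hG hY hb hg, and_iff_right hs]
  · rw [addFans_left_iff hG hY ha hg]
    exact fun h => hs h.1

end AddFans

/-- Maximal noncrossing families with a fan at each gap correspond to maximal noncrossing families
on `E` together with a choice of a direction at each gap. -/
theorem bijOn_restrict (hG : GapSystem E l r) :
    Set.BijOn (fun X : C → C → Prop =>
        ((fun p q => p ∈ E ∧ q ∈ E ∧ X p q), {s | ∃ b, RightFan E l r X s b}))
      {X | MaxNC Set.univ X ∧ HasFans E l r X} ({Y | MaxNC E Y} ×ˢ (Set.univ : Set (Set ι))) := by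
  refine ⟨fun X hX => ⟨maxNC_restrict hG hX.1 hX.2, trivial⟩, ?_, ?_⟩
  · rintro X ⟨hX, hF⟩ X' ⟨hX', hF'⟩ h
    obtain ⟨h₁, h₂⟩ := Prod.ext_iff.1 h
    have he : ∀ p ∈ E, ∀ q ∈ E, X p q ↔ X' p q := fun p hp q hq => by
      have := congrFun (congrFun h₁ p) q
      simpa [hp, hq] using this
    have hr : ∀ s, (∃ b, RightFan E l r X s b) ↔ ∃ b', RightFan E l r X' s b' := fun s =>
      Set.ext_iff.1 h₂ s
    funext p q
    exact propext ⟨rel_of_restrict_eq hG hX hF hX' hF' he hr, rel_of_restrict_eq hG hX' hF' hX hF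
      (fun p hp q hq => (he p hp q hq).symm) (fun s => (hr s).symm)⟩
  · rintro ⟨Y, ε⟩ ⟨hY, -⟩
    choose b hb using exists_isRightApex hG hY
    choose a ha using exists_isLeftApex hG hY
    refine ⟨addFans l r Y ε a b, ⟨maxNC_addFans hG hY ha hb, fun s => ?_⟩, Prod.ext ?_ ?_⟩
    · by_cases hs : s ∈ ε
      · exact Or.inl ⟨_, rightFan_addFans hG hY ha hb hs⟩
      · exact Or.inr ⟨_, leftFan_addFans hG hY ha hb hs⟩
    · funext p q
      refine propext ⟨?_, fun h => ⟨(hY.mem h).1, (hY.mem h).2.1, Or.inl h⟩⟩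
      rintro ⟨hp, hq, h | ⟨s, _, hg, _⟩ | ⟨s, _, hg, _⟩⟩
      · exact h
      · exact absurd hp (hG.notMem hg)
      · exact absurd hq (hG.notMem hg)
    · ext s
      refine ⟨fun ⟨b', hb'⟩ => ?_, fun hs => ⟨_, rightFan_addFans hG hY ha hb hs⟩⟩
      by_contra hs
      exact not_rightFan_and_leftFan hG hb' (leftFan_addFans hG hY ha hb hs)

end Extend

/-! ### The gap system of a subdivision -/

section Subdivision

variable {n : ℕ} (α : Fin (n + 1) → unitInterval)

/-- The cuts at the points of a subdivision. -/
def gridCuts : Set Cut := {c | ∃ t, c = lo (α t) ∨ c = hi (α t)}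

/-- The left end of a gap. -/
def gapLeft (s : Fin n) : Cut := hi (α s.castSucc)

/-- The right end of a gap. -/
def gapRight (s : Fin n) : Cut := lo (α s.succ)

/-- The cuts at the points of a subdivision, in increasing order. -/
def gridCut (i : ℕ) : Cut := toLex (α (Fin.ofNat (n + 1) (i / 2)), decide (i % 2 = 1))

theorem gridCut_two_mul (t : Fin (n + 1)) : gridCut α (2 * t) = lo (α t) := by
  simp [gridCut, lo]

theorem gridCut_two_mul_add_one (t : Fin (n + 1)) : gridCut α (2 * t + 1) = hi (α t) := by
  have : (2 * (t : ℕ) + 1) / 2 = t := by omega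
  simp [gridCut, hi, this]

theorem gridCuts_eq_image : gridCuts α = gridCut α '' Set.Icc 0 (2 * n + 1) := by
  ext c
  constructor
  · rintro ⟨t, rfl | rfl⟩
    · exact ⟨2 * t, ⟨Nat.zero_le _, by omega⟩, gridCut_two_mul α t⟩
    · exact ⟨2 * t + 1, ⟨Nat.zero_le _, by omega⟩, gridCut_two_mul_add_one α t⟩
  · rintro ⟨i, -, rfl⟩
    refine ⟨Fin.ofNat (n + 1) (i / 2), ?_⟩
    rcases Nat.mod_two_eq_zero_or_one i with h | h
    · exact Or.inl (by simp [gridCut, lo, h])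
    · exact Or.inr (by simp [gridCut, hi, h])

variable {α}

theorem strictMonoOn_gridCut (h_mono : StrictMono α) :
    StrictMonoOn (gridCut α) (Set.Icc 0 (2 * n + 1)) := by
  rintro i ⟨-, hi⟩ j ⟨-, hj⟩ hij
  rw [gridCut, gridCut, Prod.Lex.toLex_lt_toLex]
  rcases (Nat.div_le_div_right (c := 2) hij.le).eq_or_lt with h | h
  · right
    refine ⟨by simp only [h], ?_⟩
    have h₁ : i % 2 = 0 := by omega
    have h₂ : j % 2 = 1 := by omega
    simp [h₁, h₂]
  · left
    apply h_mono
    rw [Fin.lt_def]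
    simp only [Fin.ofNat]
    -- For indices up to 2n+1 the halves are at most n, so `Fin.ofNat` does not wrap around.
    rw [Nat.mod_eq_of_lt (by omega), Nat.mod_eq_of_lt (by omega)]
    exact h

theorem mem_gap_iff_lo {s : Fin n} {x : unitInterval} :
    (gapLeft α s < lo x ∧ lo x < gapRight α s) ↔ x ∈ Set.Ioo (α s.castSucc) (α s.succ) := by
  rw [gapLeft, gapRight, hi_lt_lo, lo_lt_lo, Set.mem_Ioo]

theorem mem_gap_iff_hi {s : Fin n} {x : unitInterval} :
    (gapLeft α s < hi x ∧ hi x < gapRight α s) ↔ x ∈ Set.Ioo (α s.castSucc) (α s.succ) := by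
  rw [gapLeft, gapRight, hi_lt_hi, hi_lt_lo, Set.mem_Ioo]

theorem exists_gap (h_zero : α 0 = 0) (h_one : α (Fin.last n) = 1) (x : unitInterval) :
    x ∈ Set.range α ∨ ∃ s : Fin n, x ∈ Set.Ioo (α s.castSucc) (α s.succ) := by
  obtain ⟨t, ht, hmax⟩ := Finset.exists_max_image (Finset.univ.filter fun t => α t ≤ x) id
    ⟨0, by simp [h_zero]⟩
  simp only [Finset.mem_filter_univ, id] at ht hmax
  by_cases hx : x ∈ Set.range α
  · exact Or.inl hx
  have hlt : α t < x := lt_of_le_of_ne ht fun h => hx ⟨t, h⟩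
  refine Or.inr ?_
  induction t using Fin.lastCases with
  | last => exact absurd (h_one ▸ hlt) (not_lt.2 unitInterval.le_one')
  | cast s =>
    refine ⟨s, hlt, ?_⟩
    by_contra! hc
    exact absurd (hmax _ hc) (not_le.2 (Fin.castSucc_lt_succ))

/-- The ends of a gap are the cut after one grid point and the cut before the next. By density of
[0,1], neither has an immediate neighbour in the gap. -/
theorem gapSystem (h_zero : α 0 = 0) (h_one : α (Fin.last n) = 1) (h_mono : StrictMono α) :
    GapSystem (gridCuts α) (gapLeft α) (gapRight α) where
  l_mem s := ⟨_, Or.inr rfl⟩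
  r_mem s := ⟨_, Or.inl rfl⟩
  lt s := hi_lt_lo.2 (h_mono Fin.castSucc_lt_succ)
  cover c := by
    obtain ⟨x, rfl | rfl⟩ := cut_cases c
    · rcases exists_gap h_zero h_one x with ⟨t, rfl⟩ | ⟨s, hs⟩
      · exact Or.inl ⟨t, Or.inl rfl⟩
      · exact Or.inr ⟨s, mem_gap_iff_lo.2 hs⟩
    · rcases exists_gap h_zero h_one x with ⟨t, rfl⟩ | ⟨s, hs⟩
      · exact Or.inl ⟨t, Or.inr rfl⟩
      · exact Or.inr ⟨s, mem_gap_iff_hi.2 hs⟩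
  avoid c hc s := by
    obtain ⟨t, h⟩ := hc
    rcases le_or_gt t s.castSucc with ht | ht
    · left
      rcases h with rfl | rfl
      · exact lo_le_hi.2 (h_mono.monotone ht)
      · exact hi_le_hi.2 (h_mono.monotone ht)
    · right
      have ht' : s.succ ≤ t := ht
      rcases h with rfl | rfl
      · exact lo_le_lo.2 (h_mono.monotone ht')
      · exact lo_le_hi.2 (h_mono.monotone ht')
  disj s s' c h₁ h₂ h₃ h₄ := by
    have key : ∀ {s s' : Fin n}, gapLeft α s' < c → c < gapRight α s → s' ≤ s := by
      intro s s' h₁ h₂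
      by_contra! hc
      have : s.succ ≤ s'.castSucc := hc
      exact absurd (lo_le_hi.2 (h_mono.monotone this)) (not_le.2 (h₁.trans h₂))
    exact le_antisymm (key h₁ h₄) (key h₃ h₂)
  below s c hc := by
    have h : ∃ x, α s.castSucc < x ∧ lo x ≤ c := by
      obtain ⟨x, rfl | rfl⟩ := cut_cases c
      · exact ⟨x, hi_lt_lo.1 hc, le_rfl⟩
      · exact ⟨x, hi_lt_hi.1 hc, (lo_lt_hi_self x).le⟩
    obtain ⟨x, h₁, h₂⟩ := h
    obtain ⟨y, h₃, h₄⟩ := exists_between h₁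
    exact ⟨lo y, hi_lt_lo.2 h₃, (lo_lt_lo.2 h₄).trans_le h₂⟩
  above s c hc := by
    have h : ∃ x, x < α s.succ ∧ c ≤ hi x := by
      obtain ⟨x, rfl | rfl⟩ := cut_cases c
      · exact ⟨x, lo_lt_lo.1 hc, (lo_lt_hi_self x).le⟩
      · exact ⟨x, hi_lt_lo.1 hc, le_rfl⟩
    obtain ⟨x, h₁, h₂⟩ := h
    obtain ⟨y, h₃, h₄⟩ := exists_between h₁
    exact ⟨hi y, h₂.trans_lt (hi_lt_hi.2 h₃), hi_lt_lo.2 h₄⟩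
  fin := by
    rw [gridCuts_eq_image]
    exact (Set.finite_Icc _ _).image _
  bot := by
    refine ⟨lo (α 0), ⟨0, Or.inl rfl⟩, fun c => ?_⟩
    obtain ⟨x, rfl | rfl⟩ := cut_cases c
    · exact lo_le_lo.2 (h_zero ▸ unitInterval.nonneg')
    · exact lo_le_hi.2 (h_zero ▸ unitInterval.nonneg')
  top := by
    refine ⟨hi (α (Fin.last n)), ⟨Fin.last n, Or.inr rfl⟩, fun c => ?_⟩
    obtain ⟨x, rfl | rfl⟩ := cut_cases c
    · exact lo_le_hi.2 (h_one ▸ unitInterval.le_one')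
    · exact hi_le_hi.2 (h_one ▸ unitInterval.le_one')

end Subdivision

/-! ### Sets of intervals as families of pairs of cuts -/

section Translation

/-- The family of pairs of cuts that belongs to a set of intervals. -/
def pairs (X : Set Interval) (p q : Cut) : Prop := ∃ h : p < q, itv h ∈ X

theorem pairs_itv {X : Set Interval} {p q : Cut} (h : p < q) : pairs X p q ↔ itv h ∈ X :=
  ⟨fun ⟨_, h'⟩ => h', fun h' => ⟨h, h'⟩⟩

theorem pairs_injective : Function.Injective pairs := by
  intro X Y h
  ext S
  obtain ⟨p, q, hpq, rfl⟩ := exists_eq_itv S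
  rw [← pairs_itv, ← pairs_itv, h]

theorem exists_pairs_eq {R : Cut → Cut → Prop} (hR : ∀ p q, R p q → p < q) :
    ∃ X, pairs X = R := by
  refine ⟨{S | ∃ p q, S.1 = cutSet p q ∧ R p q}, ?_⟩
  funext p q
  refine propext ⟨?_, fun h => ⟨hR p q h, p, q, rfl, h⟩⟩
  rintro ⟨h, p', q', he, h'⟩
  obtain ⟨rfl, rfl⟩ := cutSet_inj h (hR _ _ h') he
  exact h'

theorem cutSet_mem_iff {X : Set Interval} {p q : Cut} :
    cutSet p q ∈ Subtype.val '' X ↔ pairs X p q := by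
  constructor
  · rintro ⟨S, hS, he⟩
    obtain ⟨x, hx⟩ := S.2.1
    rw [he] at hx
    have h : p < q := hx.1.trans_lt ((lo_lt_hi_self x).trans_le hx.2)
    refine ⟨h, ?_⟩
    rwa [show itv h = S from Subtype.ext he.symm]
  · rintro ⟨h, h'⟩
    exact ⟨_, h', rfl⟩

theorem rigid_maximal_iff_maxNC (k : Type u) [Field k] (X : Set Interval) :
    (RigidSet k X ∧ ∀ S, RigidSet k (insert S X) → S ∈ X) ↔ MaxNC Set.univ (pairs X) := by
  have hrig : RigidSet k X ↔ ∀ p q p' q', pairs X p q → pairs X p' q' → ¬ Crosses p q p' q' := by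
    constructor
    · rintro h p q p' q' ⟨h₁, h₂⟩ ⟨h₁', h₂'⟩
      exact (subsingleton_ext_iff h₁ h₁').1 (h _ h₂ _ h₂')
    · intro h S hS T hT
      obtain ⟨p, q, hpq, rfl⟩ := exists_eq_itv S
      obtain ⟨p', q', hpq', rfl⟩ := exists_eq_itv T
      exact (subsingleton_ext_iff hpq hpq').2 (h _ _ _ _ ⟨hpq, hS⟩ ⟨hpq', hT⟩)
  constructor
  · rintro ⟨h, hmax⟩
    refine ⟨fun h' => ⟨trivial, trivial, h'.1⟩, fun h₁ h₂ => hrig.1 h _ _ _ _ h₁ h₂,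
      fun {p q} _ _ hpq hc => ⟨hpq, hmax _ ?_⟩⟩
    rintro S (rfl | hS) T (rfl | hT)
    · exact (subsingleton_ext_iff hpq hpq).2 fun h => lt_irrefl _ h.1
    · obtain ⟨p', q', hpq', rfl⟩ := exists_eq_itv T
      exact (subsingleton_ext_iff hpq hpq').2 (hc _ _ ⟨hpq', hT⟩).1
    · obtain ⟨p', q', hpq', rfl⟩ := exists_eq_itv S
      exact (subsingleton_ext_iff hpq' hpq).2 (hc _ _ ⟨hpq', hS⟩).2
    · exact h S hS T hT
  · intro h
    refine ⟨hrig.2 fun _ _ _ _ h₁ h₂ => h.nc h₁ h₂, fun S hS => ?_⟩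
    obtain ⟨p, q, hpq, rfl⟩ := exists_eq_itv S
    refine (pairs_itv hpq).1 (h.max trivial trivial hpq fun p' q' ⟨hpq', hX⟩ => ⟨?_, ?_⟩)
    · exact (subsingleton_ext_iff hpq hpq').1 (hS _ (Or.inl rfl) _ (Or.inr hX))
    · exact (subsingleton_ext_iff hpq' hpq).1 (hS _ (Or.inr hX) _ (Or.inl rfl))

theorem encard_sum_eq_one_iff {T : Type*} {A B C D : Set T} :
    A.encard + B.encard + C.encard + D.encard = 1 ↔
      ((∃ x, A = {x}) ∧ B = ∅ ∧ C = ∅ ∧ D = ∅) ∨ (A = ∅ ∧ (∃ x, B = {x}) ∧ C = ∅ ∧ D = ∅) ∨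
      (A = ∅ ∧ B = ∅ ∧ (∃ x, C = {x}) ∧ D = ∅) ∨ (A = ∅ ∧ B = ∅ ∧ C = ∅ ∧ ∃ x, D = {x}) := by
  simp only [← Set.encard_eq_one, ← Set.encard_eq_zero]
  generalize A.encard = a
  generalize B.encard = b
  generalize C.encard = c
  generalize D.encard = d
  induction a using ENat.recTopCoe with
  | top => simp
  | coe a =>
  induction b using ENat.recTopCoe with
  | top => simp
  | coe b =>
  induction c using ENat.recTopCoe with
  | top => simp
  | coe c =>
  induction d using ENat.recTopCoe with
  | top => simp
  | coe d =>
  norm_cast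
  omega

/-! ### Type α as the existence of fans -/

variable {n : ℕ} {α : Fin (n + 1) → unitInterval}

/-- The pairs of cuts with one entry in the gap `s` and the other one outside are described by
sets `A₁`, `A₂`, `B₁`, `B₂` of points of the subdivision, with one element in total. -/
def GapData (α : Fin (n + 1) → unitInterval) (R : Cut → Cut → Prop) (s : Fin n)
    (A₁ A₂ B₁ B₂ : Set unitInterval) : Prop :=
  (A₁ ∪ A₂ ∪ B₁ ∪ B₂ ⊆ Set.range α ∧ A₁ ∪ A₂ ⊆ Set.Ici (α s.succ) ∧
    B₁ ∪ B₂ ⊆ Set.Iic (α s.castSucc)) ∧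
  A₁.encard + A₂.encard + B₁.encard + B₂.encard = 1 ∧
  ∀ g, gapLeft α s < g ∧ g < gapRight α s → ∀ d,
    (α s.succ ≤ d → (R g (hi d) ↔ d ∈ A₁) ∧ (R g (lo d) ↔ d ∈ A₂)) ∧
    (d ≤ α s.castSucc → (R (lo d) g ↔ d ∈ B₁) ∧ (R (hi d) g ↔ d ∈ B₂))

/-- The eight sets at c list the partners outside the gap of the cuts `lo c` and `hi c`. The
equalities such as φ₁ = φ₃ say that these two cuts have the same partners, and constancy extends
this to all cuts of the gap. -/
theorem intervalsOfType_iff_gapData (h_mono : StrictMono α) (X : Set Interval) :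
    IntervalsOfType α (Subtype.val '' X) ↔
      ∀ s, ∃ A₁ A₂ B₁ B₂, GapData α (pairs X) s A₁ A₂ B₁ B₂ := by
  have m₁ : ∀ s c d, d ∈ phiR1 α (Subtype.val '' X) s c ↔ α s.succ ≤ d ∧ pairs X (lo c) (hi d) :=
    fun s c d => by rw [← cutSet_mem_iff, cutSet_lo_hi]; rfl
  have m₂ : ∀ s c d, d ∈ phiR2 α (Subtype.val '' X) s c ↔ α s.succ ≤ d ∧ pairs X (lo c) (lo d) :=
    fun s c d => by rw [← cutSet_mem_iff, cutSet_lo_lo]; rfl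
  have m₃ : ∀ s c d, d ∈ phiR3 α (Subtype.val '' X) s c ↔ α s.succ ≤ d ∧ pairs X (hi c) (hi d) :=
    fun s c d => by rw [← cutSet_mem_iff, cutSet_hi_hi]; rfl
  have m₄ : ∀ s c d, d ∈ phiR4 α (Subtype.val '' X) s c ↔ α s.succ ≤ d ∧ pairs X (hi c) (lo d) :=
    fun s c d => by rw [← cutSet_mem_iff, cutSet_hi_lo]; rfl
  have m₅ : ∀ s c d, d ∈ phiL1 α (Subtype.val '' X) s c ↔
      d ≤ α s.castSucc ∧ pairs X (lo d) (hi c) :=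
    fun s c d => by rw [← cutSet_mem_iff, cutSet_lo_hi]; rfl
  have m₆ : ∀ s c d, d ∈ phiL2 α (Subtype.val '' X) s c ↔
      d ≤ α s.castSucc ∧ pairs X (hi d) (hi c) :=
    fun s c d => by rw [← cutSet_mem_iff, cutSet_hi_hi]; rfl
  have m₇ : ∀ s c d, d ∈ phiL3 α (Subtype.val '' X) s c ↔
      d ≤ α s.castSucc ∧ pairs X (lo d) (lo c) :=
    fun s c d => by rw [← cutSet_mem_iff, cutSet_lo_lo]; rfl
  have m₈ : ∀ s c d, d ∈ phiL4 α (Subtype.val '' X) s c ↔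
      d ≤ α s.castSucc ∧ pairs X (hi d) (lo c) :=
    fun s c d => by rw [← cutSet_mem_iff, cutSet_hi_lo]; rfl
  constructor
  · intro h s
    obtain ⟨c, hc⟩ := exists_between (h_mono (Fin.castSucc_lt_succ (i := s)))
    refine ⟨phiR1 α (Subtype.val '' X) s c, phiR2 α (Subtype.val '' X) s c,
      phiL1 α (Subtype.val '' X) s c, phiL2 α (Subtype.val '' X) s c, ⟨?_, ?_, ?_⟩,
      h.card s c hc, ?_⟩
    · refine Set.union_subset (Set.union_subset (Set.union_subset ?_ ?_) ?_) ?_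
      · rw [(h.r13 s c hc).1]; exact (h.r13 s c hc).2
      · rw [(h.r24 s c hc).1]; exact (h.r24 s c hc).2
      · rw [(h.l13 s c hc).1]; exact (h.l13 s c hc).2
      · rw [(h.l24 s c hc).1]; exact (h.l24 s c hc).2
    · exact Set.union_subset (fun d hd => hd.1) fun d hd => hd.1
    · exact Set.union_subset (fun d hd => hd.1) fun d hd => hd.1
    · intro g hg d
      obtain ⟨x, rfl | rfl⟩ := cut_cases g
      · have hx := mem_gap_iff_lo.1 hg
        obtain ⟨c₁, c₂, -, -, c₅, c₆, -, -⟩ := h.const s c hc x hx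
        refine ⟨fun hd => ?_, fun hd => ?_⟩
        · rw [c₁, c₂, m₁, m₂]
          exact ⟨(and_iff_right hd).symm, (and_iff_right hd).symm⟩
        · rw [c₅, c₆, (h.l13 s x hx).1, (h.l24 s x hx).1, m₇, m₈]
          exact ⟨(and_iff_right hd).symm, (and_iff_right hd).symm⟩
      · have hx := mem_gap_iff_hi.1 hg
        obtain ⟨c₁, c₂, -, -, c₅, c₆, -, -⟩ := h.const s c hc x hx
        refine ⟨fun hd => ?_, fun hd => ?_⟩
        · rw [c₁, c₂, (h.r13 s x hx).1, (h.r24 s x hx).1, m₃, m₄]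
          exact ⟨(and_iff_right hd).symm, (and_iff_right hd).symm⟩
        · rw [c₅, c₆, m₅, m₆]
          exact ⟨(and_iff_right hd).symm, (and_iff_right hd).symm⟩
  · intro h
    choose A₁ A₂ B₁ B₂ hsub hcard hiff using h
    have key : ∀ s, ∀ c ∈ Set.Ioo (α s.castSucc) (α s.succ),
        (phiR1 α (Subtype.val '' X) s c = A₁ s ∧ phiR2 α (Subtype.val '' X) s c = A₂ s) ∧
        (phiR3 α (Subtype.val '' X) s c = A₁ s ∧ phiR4 α (Subtype.val '' X) s c = A₂ s) ∧
        (phiL1 α (Subtype.val '' X) s c = B₁ s ∧ phiL2 α (Subtype.val '' X) s c = B₂ s) ∧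
        (phiL3 α (Subtype.val '' X) s c = B₁ s ∧ phiL4 α (Subtype.val '' X) s c = B₂ s) := by
      intro s c hc
      have eR : ∀ {d}, α s.succ ≤ d → _ := fun {d} hd =>
        And.intro ((hiff s _ (mem_gap_iff_lo.2 hc) d).1 hd)
          ((hiff s _ (mem_gap_iff_hi.2 hc) d).1 hd)
      have eL : ∀ {d}, d ≤ α s.castSucc → _ := fun {d} hd =>
        And.intro ((hiff s _ (mem_gap_iff_lo.2 hc) d).2 hd)
          ((hiff s _ (mem_gap_iff_hi.2 hc) d).2 hd)
      have sA : ∀ {d}, d ∈ A₁ s ∪ A₂ s → α s.succ ≤ d := fun hd => (hsub s).2.1 hd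
      have sB : ∀ {d}, d ∈ B₁ s ∪ B₂ s → d ≤ α s.castSucc := fun hd => (hsub s).2.2 hd
      refine ⟨⟨?_, ?_⟩, ⟨?_, ?_⟩, ⟨?_, ?_⟩, ?_, ?_⟩ <;> ext d
      · rw [m₁]
        exact ⟨fun h => (eR h.1).1.1.1 h.2, fun h => ⟨sA (Or.inl h), (eR (sA (Or.inl h))).1.1.2 h⟩⟩
      · rw [m₂]
        exact ⟨fun h => (eR h.1).1.2.1 h.2, fun h => ⟨sA (Or.inr h), (eR (sA (Or.inr h))).1.2.2 h⟩⟩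
      · rw [m₃]
        exact ⟨fun h => (eR h.1).2.1.1 h.2, fun h => ⟨sA (Or.inl h), (eR (sA (Or.inl h))).2.1.2 h⟩⟩
      · rw [m₄]
        exact ⟨fun h => (eR h.1).2.2.1 h.2, fun h => ⟨sA (Or.inr h), (eR (sA (Or.inr h))).2.2.2 h⟩⟩
      · rw [m₅]
        exact ⟨fun h => (eL h.1).2.1.1 h.2, fun h => ⟨sB (Or.inl h), (eL (sB (Or.inl h))).2.1.2 h⟩⟩
      · rw [m₆]
        exact ⟨fun h => (eL h.1).2.2.1 h.2, fun h => ⟨sB (Or.inr h), (eL (sB (Or.inr h))).2.2.2 h⟩⟩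
      · rw [m₇]
        exact ⟨fun h => (eL h.1).1.1.1 h.2, fun h => ⟨sB (Or.inl h), (eL (sB (Or.inl h))).1.1.2 h⟩⟩
      · rw [m₈]
        exact ⟨fun h => (eL h.1).1.2.1 h.2, fun h => ⟨sB (Or.inr h), (eL (sB (Or.inr h))).1.2.2 h⟩⟩
    refine ⟨fun s c hc => ?_, fun s c hc => ?_, fun s c hc => ?_, fun s c hc => ?_,
      fun s c hc => ?_, fun s c hc f hf => ?_⟩
    · obtain ⟨⟨e₁, e₂⟩, ⟨e₃, e₄⟩, ⟨e₅, e₆⟩, e₇, e₈⟩ := key s c hc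
      exact ⟨e₁.trans e₃.symm, e₃ ▸ fun d hd => (hsub s).1 (Or.inl (Or.inl (Or.inl hd)))⟩
    · obtain ⟨⟨e₁, e₂⟩, ⟨e₃, e₄⟩, ⟨e₅, e₆⟩, e₇, e₈⟩ := key s c hc
      exact ⟨e₂.trans e₄.symm, e₄ ▸ fun d hd => (hsub s).1 (Or.inl (Or.inl (Or.inr hd)))⟩
    · obtain ⟨⟨e₁, e₂⟩, ⟨e₃, e₄⟩, ⟨e₅, e₆⟩, e₇, e₈⟩ := key s c hc
      exact ⟨e₅.trans e₇.symm, e₇ ▸ fun d hd => (hsub s).1 (Or.inl (Or.inr hd))⟩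
    · obtain ⟨⟨e₁, e₂⟩, ⟨e₃, e₄⟩, ⟨e₅, e₆⟩, e₇, e₈⟩ := key s c hc
      exact ⟨e₆.trans e₈.symm, e₈ ▸ fun d hd => (hsub s).1 (Or.inr hd)⟩
    · obtain ⟨⟨e₁, e₂⟩, ⟨e₃, e₄⟩, ⟨e₅, e₆⟩, e₇, e₈⟩ := key s c hc
      rw [e₁, e₂, e₅, e₆]
      exact hcard s
    · obtain ⟨⟨e₁, e₂⟩, ⟨e₃, e₄⟩, ⟨e₅, e₆⟩, e₇, e₈⟩ := key s c hc
      obtain ⟨⟨f₁, f₂⟩, ⟨f₃, f₄⟩, ⟨f₅, f₆⟩, f₇, f₈⟩ := key s f hf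
      exact ⟨e₁.trans f₁.symm, e₂.trans f₂.symm, e₃.trans f₃.symm, e₄.trans f₄.symm,
        e₅.trans f₅.symm, e₆.trans f₆.symm, e₇.trans f₇.symm, e₈.trans f₈.symm⟩

theorem lo_ne_hi {x y : unitInterval} : lo x ≠ hi y := by
  intro h
  have : (false : Bool) = true := congrArg (fun c => (ofLex c).2) h
  exact Bool.false_ne_true this

theorem lo_inj {x y : unitInterval} : lo x = lo y ↔ x = y :=
  ⟨fun h => congrArg (fun c => (ofLex c).1) h, fun h => h ▸ rfl⟩

theorem hi_inj {x y : unitInterval} : hi x = hi y ↔ x = y :=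
  ⟨fun h => congrArg (fun c => (ofLex c).1) h, fun h => h ▸ rfl⟩

theorem rightFan_iff {R : Cut → Cut → Prop} {s : Fin n} {b : Cut} :
    RightFan (gridCuts α) (gapLeft α) (gapRight α) R s b ↔
      b ∈ gridCuts α ∧ gapRight α s ≤ b ∧ ∀ g, gapLeft α s < g ∧ g < gapRight α s → ∀ d,
        (α s.succ ≤ d → (R g (hi d) ↔ hi d = b) ∧ (R g (lo d) ↔ lo d = b)) ∧
        (d ≤ α s.castSucc → ¬ R (lo d) g ∧ ¬ R (hi d) g) := by
  refine and_congr_right fun _ => and_congr_right fun _ => forall₂_congr fun g _ => ?_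
  constructor
  · exact fun h d => ⟨fun hd => ⟨h.1 _ (lo_le_hi.2 hd), h.1 _ (lo_le_lo.2 hd)⟩,
      fun hd => ⟨h.2 _ (lo_le_hi.2 hd), h.2 _ (hi_le_hi.2 hd)⟩⟩
  · refine fun h => ⟨fun q hq => ?_, fun p hp => ?_⟩
    · obtain ⟨d, rfl | rfl⟩ := cut_cases q
      · exact ((h d).1 (lo_le_lo.1 hq)).2
      · exact ((h d).1 (lo_le_hi.1 hq)).1
    · obtain ⟨d, rfl | rfl⟩ := cut_cases p
      · exact ((h d).2 (lo_le_hi.1 hp)).1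
      · exact ((h d).2 (hi_le_hi.1 hp)).2

theorem leftFan_iff {R : Cut → Cut → Prop} {s : Fin n} {a : Cut} :
    LeftFan (gridCuts α) (gapLeft α) (gapRight α) R s a ↔
      a ∈ gridCuts α ∧ a ≤ gapLeft α s ∧ ∀ g, gapLeft α s < g ∧ g < gapRight α s → ∀ d,
        (α s.succ ≤ d → ¬ R g (hi d) ∧ ¬ R g (lo d)) ∧
        (d ≤ α s.castSucc → (R (lo d) g ↔ lo d = a) ∧ (R (hi d) g ↔ hi d = a)) := by
  refine and_congr_right fun _ => and_congr_right fun _ => forall₂_congr fun g _ => ?_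
  constructor
  · exact fun h d => ⟨fun hd => ⟨h.2 _ (lo_le_hi.2 hd), h.2 _ (lo_le_lo.2 hd)⟩,
      fun hd => ⟨h.1 _ (lo_le_hi.2 hd), h.1 _ (hi_le_hi.2 hd)⟩⟩
  · refine fun h => ⟨fun p hp => ?_, fun q hq => ?_⟩
    · obtain ⟨d, rfl | rfl⟩ := cut_cases p
      · exact ((h d).2 (lo_le_hi.1 hp)).1
      · exact ((h d).2 (hi_le_hi.1 hp)).2
    · obtain ⟨d, rfl | rfl⟩ := cut_cases q
      · exact ((h d).1 (lo_le_lo.1 hq)).2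
      · exact ((h d).1 (lo_le_hi.1 hq)).1

theorem mem_gridCuts_lo {x : unitInterval} : lo x ∈ gridCuts α ↔ x ∈ Set.range α := by
  simp [gridCuts, lo_inj, lo_ne_hi, eq_comm (a := x)]

theorem mem_gridCuts_hi {x : unitInterval} : hi x ∈ gridCuts α ↔ x ∈ Set.range α := by
  simp [gridCuts, hi_inj, lo_ne_hi.symm, eq_comm (a := x)]

/-- Exactly one of the four sets is a singleton {x}; which one decides the side of the fan and
whether its apex is `lo x` or `hi x`. -/
theorem exists_gapData_iff_fan {R : Cut → Cut → Prop} {s : Fin n} :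
    (∃ A₁ A₂ B₁ B₂, GapData α R s A₁ A₂ B₁ B₂) ↔
      (∃ b, RightFan (gridCuts α) (gapLeft α) (gapRight α) R s b) ∨
        ∃ a, LeftFan (gridCuts α) (gapLeft α) (gapRight α) R s a := by
  simp only [rightFan_iff, leftFan_iff]
  constructor
  · rintro ⟨A₁, A₂, B₁, B₂, ⟨h₁, h₂, h₃⟩, hc, h⟩
    rcases encard_sum_eq_one_iff.1 hc with ⟨⟨x, rfl⟩, rfl, rfl, rfl⟩ | ⟨rfl, ⟨x, rfl⟩, rfl, rfl⟩ |
      ⟨rfl, rfl, ⟨x, rfl⟩, rfl⟩ | ⟨rfl, rfl, rfl, ⟨x, rfl⟩⟩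
    · refine Or.inl ⟨hi x, mem_gridCuts_hi.2 (h₁ (by simp)), lo_le_hi.2 (h₂ (by simp)), ?_⟩
      simpa [hi_inj, lo_ne_hi] using h
    · refine Or.inl ⟨lo x, mem_gridCuts_lo.2 (h₁ (by simp)), lo_le_lo.2 (h₂ (by simp)), ?_⟩
      simpa [lo_inj, lo_ne_hi.symm] using h
    · refine Or.inr ⟨lo x, mem_gridCuts_lo.2 (h₁ (by simp)), lo_le_hi.2 (h₃ (by simp)), ?_⟩
      simpa [lo_inj, lo_ne_hi.symm] using h
    · refine Or.inr ⟨hi x, mem_gridCuts_hi.2 (h₁ (by simp)), hi_le_hi.2 (h₃ (by simp)), ?_⟩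
      simpa [hi_inj, lo_ne_hi] using h
  · rintro (⟨b, hb, hsb, h⟩ | ⟨a, ha, hsa, h⟩)
    · obtain ⟨x, rfl | rfl⟩ := cut_cases b
      · have hx := mem_gridCuts_lo.1 hb
        have hx' : α s.succ ≤ x := lo_le_lo.1 hsb
        refine ⟨∅, {x}, ∅, ∅, ?_, by simp, ?_⟩
        · simpa [hx'] using hx
        · simpa [lo_inj, lo_ne_hi.symm] using h
      · have hx := mem_gridCuts_hi.1 hb
        have hx' : α s.succ ≤ x := lo_le_hi.1 hsb
        refine ⟨{x}, ∅, ∅, ∅, ?_, by simp, ?_⟩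
        · simpa [hx'] using hx
        · simpa [hi_inj, lo_ne_hi] using h
    · obtain ⟨x, rfl | rfl⟩ := cut_cases a
      · have hx := mem_gridCuts_lo.1 ha
        have hx' : x ≤ α s.castSucc := lo_le_hi.1 hsa
        refine ⟨∅, ∅, {x}, ∅, ?_, by simp, ?_⟩
        · simpa [hx'] using hx
        · simpa [lo_inj, lo_ne_hi.symm] using h
      · have hx := mem_gridCuts_hi.1 ha
        have hx' : x ≤ α s.castSucc := hi_le_hi.1 hsa
        refine ⟨∅, ∅, ∅, {x}, ?_, by simp, ?_⟩
        · simpa [hx'] using hx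
        · simpa [hi_inj, lo_ne_hi] using h

theorem intervalsOfType_iff_hasFans (h_mono : StrictMono α) (X : Set Interval) :
    IntervalsOfType α (Subtype.val '' X) ↔
      HasFans (gridCuts α) (gapLeft α) (gapRight α) (pairs X) := by
  rw [intervalsOfType_iff_gapData h_mono]
  exact forall_congr' fun s => exists_gapData_iff_fan

/-- The sets of intervals of maximal rigid representations of type `α` correspond to maximal
noncrossing families on the grid together with a choice of a direction at each gap. -/
theorem exists_bijOn_rigid (k : Type u) [Field k] (h_zero : α 0 = 0) (h_one : α (Fin.last n) = 1)
    (h_mono : StrictMono α) :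
    ∃ f, Set.BijOn f {X | RigidSet k X ∧ (∀ S, RigidSet k (insert S X) → S ∈ X) ∧
        IntervalsOfType α (Subtype.val '' X)}
      ({Y | MaxNC (gridCuts α) Y} ×ˢ (Set.univ : Set (Set (Fin n)))) := by
  refine ⟨_, (bijOn_restrict (gapSystem h_zero h_one h_mono)).comp
    (⟨fun X hX => ?_, pairs_injective.injOn, fun R hR => ?_⟩ : Set.BijOn pairs _ _)⟩
  · obtain ⟨h₁, h₂, h₃⟩ := hX
    exact ⟨(rigid_maximal_iff_maxNC k X).1 ⟨h₁, h₂⟩, (intervalsOfType_iff_hasFans h_mono X).1 h₃⟩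
  · obtain ⟨X, rfl⟩ := exists_pairs_eq (R := R) fun p q h => (hR.1.mem h).2.2
    have := (rigid_maximal_iff_maxNC k X).2 hR.1
    exact ⟨X, ⟨this.1, this.2, (intervalsOfType_iff_hasFans h_mono X).2 hR.2⟩, rfl⟩

end Translation

end ContinuousQuiver

/-! ### The count -/

theorem two_pow_mul_catalan (n : ℕ) : ((catalan (2 * n + 1) * 2 ^ n : ℕ) : ℚ) =
    (2 : ℚ) ^ ((n : ℤ) - 1) / ((n : ℚ) + 1) * (Nat.choose (4 * n + 2) (2 * n + 1) : ℚ) := by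
  have h := succ_mul_catalan_eq_centralBinom (2 * n + 1)
  rw [Nat.centralBinom, show 2 * (2 * n + 1) = 4 * n + 2 by ring] at h
  rw [← h, zpow_sub_one₀ (two_ne_zero), zpow_natCast]
  push_cast
  field_simp
  ring

theorem theorem2p3 (k : Type u) [Field k] (n : ℕ) (α : Fin (n + 1) → unitInterval)
    (h_zero : α 0 = 0) (h_one : α (Fin.last n) = 1) (h_mono : StrictMono α) :
    (ContinuousQuiver.maximalRigidClasses k α).Finite ∧
      ((ContinuousQuiver.maximalRigidClasses k α).ncard : ℚ) =
        (2 : ℚ) ^ ((n : ℤ) - 1) / ((n : ℚ) + 1) * (Nat.choose (4 * n + 2) (2 * n + 1) : ℚ) := by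
  obtain ⟨f, hf⟩ := ContinuousQuiver.exists_bijOn_rigid k h_zero h_one h_mono
  have hE := ContinuousQuiver.strictMonoOn_gridCut h_mono
  have hfin := ContinuousQuiver.finite_setOf_maxNC_image hE
  have hcard := ContinuousQuiver.ncard_setOf_maxNC_image hE
  rw [← ContinuousQuiver.gridCuts_eq_image] at hfin hcard
  rw [ContinuousQuiver.maximalRigidClasses_eq_image]
  refine ⟨(hf.finite_iff_finite.2 (hfin.prod Set.finite_univ)).image _, ?_⟩
  -- The 2n+2 grid cuts contribute the Catalan number of index 2n+1, and the set of gaps with a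
  -- right fan is an arbitrary subset of the n gaps.
  rw [(ContinuousQuiver.repOfSet_class_injective.injOn).ncard_image, ← hf.injOn.ncard_image,
    hf.image_eq, Set.ncard_prod, hcard, Set.ncard_univ, Nat.card_eq_fintype_card, Fintype.card_set,
    Fintype.card_fin, two_pow_mul_catalan]
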